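/- Proposition 3.6. Let $H=[0,+\infty)\times\mathbb{R}$ and let $E\subset H$ be an $\mathcal{L}^2$-measurable set with $\mathcal{L}^2(E)<+\infty$ and finite Euclidean (De Giorgi) perimeter $P(E)<+\infty$. For $t\in\mathbb{R}$ put $E^x_t=\{y:(t,y)\in E\}$ and $E^y_t=\{x:(x,t)\in E\}$. Assume that $E$ is $y$-Schwarz symmetric: $(x,y)\in E$ implies $(x,-y)\in E$, and $E^x_t$ is a (possibly empty or unbounded) open interval for every $t\in\mathbb{R}$. (1) If $E$ is $x$-convex, i.e. $E^y_t$ is a (possibly empty or unbounded) open interval for every $t\in\mathbb{R}$, then $E$ is bounded and its topological boundary $\partial E$ is piecewise Lipschitz. (2) Whether or not $E$ is $x$-convex, its horizontal rearrangement $E^\bigstar$ is bounded and its topological boundary $\partial E^\bigstar$ is piecewise Lipschitz. Here a set $\Gamma\subset\mathbb{R}^2$ is called piecewise Lipschitz if it is the union of a finite (possibly empty) family of arcs, each of which is, in some orthonormal coordinate system, the graph of a Lipschitz function over a nondegenerate compact interval, and two different arcs of the family meet at most at common endpoints. The set $E^\bigstar$ is defined as follows. For measurable $A\subset\mathbb{R}$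 let $\operatorname{ess\,inf}A=\sup\{t\in\mathbb{R}:\mathcal{L}^1(A\cap(-\infty,t))=0\}$. Let $\lambda_E,\phi_E:\mathbb{R}\to[0,+\infty]$ be the even, left-continuous on $(0,+\infty)$, representatives of $t\mapsto\mathcal{L}^1(E^y_t)$ and $t\mapsto\operatorname{ess\,inf}E^y_t$, that is, $$\lambda_E(t)=\lim_{s\to|t|^-}\mathcal{L}^1(E^y_s),\qquad \phi_E(t)=\lim_{s\to|t|^-}\operatorname{ess\,inf}E^y_s .$$ Let $D\subset(0,+\infty)$ be the set of the points $d$ with $\phi_E(d)<+\infty$ at which $\phi_E$ is discontinuous; for $d\in D$ let $$j_d=\big((\phi_E(d+)-\phi_E(d))-(\lambda_E(d)-\lambda_E(d+))\big)^+ ,$$ where $d+$ denotes the right limit, and let $\tau_E(t)=\sum_{d\in D}j_d\,\chi_{(d,+\infty)}(|t|)$. Then $$E^\bigstar=\{(x,y)\in\mathbb{R}^2:\ \phi_E(y)<+\infty,\ 0<x-\phi_E(y)+\tau_E(y)<\lambda_E(y)\}.$$ -/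

import Mathlib

open MeasureTheory Set
open scoped ENNReal NNReal

/-- The closed right half-plane `[0, ∞) × ℝ`. -/
def closedHalfPlane : Set (ℝ × ℝ) := {p | 0 ≤ p.1}

/-- The horizontal section `{x : (x, t) ∈ E}` of `E` at height `t`. -/
def horizSection (E : Set (ℝ × ℝ)) (t : ℝ) : Set ℝ := {x | (x, t) ∈ E}

/-- The vertical section `{y : (t, y) ∈ E}` of `E` at abscissa `t`. -/
def vertSection (E : Set (ℝ × ℝ)) (t : ℝ) : Set ℝ := {y | (t, y) ∈ E}

/-- Open intervals of the real line, possibly empty or unbounded. -/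
def IsOpenInterval (I : Set ℝ) : Prop := IsOpen I ∧ I.OrdConnected

/-- `E` is `x`-convex: every horizontal section is an open interval. -/
def IsXConvex (E : Set (ℝ × ℝ)) : Prop := ∀ t : ℝ, IsOpenInterval (horizSection E t)

/-- `E` is `y`-convex: every vertical section is an open interval. -/
def IsYConvex (E : Set (ℝ × ℝ)) : Prop := ∀ t : ℝ, IsOpenInterval (vertSection E t)

/-- `E` is `y`-symmetric: invariant under the reflection `(x, y) ↦ (x, -y)`. -/
def IsYSymmetric (E : Set (ℝ × ℝ)) : Prop := ∀ x y : ℝ, (x, y) ∈ E → (x, -y) ∈ E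

/-- `E` is `y`-Schwarz symmetric: `y`-symmetric and `y`-convex. -/
def IsYSchwarzSymmetric (E : Set (ℝ × ℝ)) : Prop := IsYSymmetric E ∧ IsYConvex E

/-- The divergence `∂ₓ X₁ + ∂ᵧ X₂` of a planar vector field. -/
noncomputable def planeDiv (X : ℝ × ℝ → ℝ × ℝ) (p : ℝ × ℝ) : ℝ :=
  (fderiv ℝ X p (1, 0)).1 + (fderiv ℝ X p (0, 1)).2

/-- The Euclidean (De Giorgi) perimeter of `E`: the supremum of `∫_E div X` over the compactly
supported `C¹` vector fields `X` of Euclidean length at most one. The field `X = 0` is admissible,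
so that cutting negative values at zero does not change the supremum. -/
noncomputable def perimeter (E : Set (ℝ × ℝ)) : ℝ≥0∞ :=
  ⨆ (X : ℝ × ℝ → ℝ × ℝ) (_ : ContDiff ℝ 1 X) (_ : HasCompactSupport X)
    (_ : ∀ p, Real.sqrt ((X p).1 ^ 2 + (X p).2 ^ 2) ≤ 1),
    ENNReal.ofReal (∫ p in E, planeDiv X p)

/-- The essential infimum `sup {t ∈ ℝ : |A ∩ (-∞, t)| = 0}` of a set of reals, as an extended
real number. -/
noncomputable def essInfSet (A : Set ℝ) : EReal :=
  sSup {s : EReal | ∃ t : ℝ, s = (t : EReal) ∧ volume (A ∩ Iio t) = 0}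

/-- The length of the horizontal section of `E` at height `t`. -/
noncomputable def sectionLength (E : Set (ℝ × ℝ)) (t : ℝ) : ℝ≥0∞ := volume (horizSection E t)

/-- The essential infimum of the horizontal section of `E` at height `t`. It is nonnegative when
`E` lies in the closed right half-plane. -/
noncomputable def sectionEssInf (E : Set (ℝ × ℝ)) (t : ℝ) : ℝ≥0∞ :=
  (essInfSet (horizSection E t)).toENNReal

/-- `λ_E`: the even representative of the section length, left-continuous on `(0, ∞)`. -/
noncomputable def lambdaFun (E : Set (ℝ × ℝ)) (t : ℝ) : ℝ≥0∞ :=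
  Function.leftLim (sectionLength E) |t|

/-- `φ_E`: the even representative of the essential infimum of the sections, left-continuous on
`(0, ∞)`. -/
noncomputable def phiFun (E : Set (ℝ × ℝ)) (t : ℝ) : ℝ≥0∞ :=
  Function.leftLim (sectionEssInf E) |t|

/-- The set of the points of `(0, ∞)` where `φ_E` is finite and discontinuous. -/
def jumpSet (E : Set (ℝ × ℝ)) : Set ℝ :=
  {d | 0 < d ∧ phiFun E d ≠ ⊤ ∧ ¬ ContinuousAt (phiFun E) d}

/-- `((φ_E(d+) - φ_E(d)) - (λ_E(d) - λ_E(d+)))⁺`; subtraction in `[0, ∞]` is truncated at zero. -/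
noncomputable def jumpSize (E : Set (ℝ × ℝ)) (d : ℝ) : ℝ≥0∞ :=
  (Function.rightLim (phiFun E) d - phiFun E d) - (lambdaFun E d - Function.rightLim (lambdaFun E) d)

/-- `τ_E(t) = ∑_d j_d 1_{(d, ∞)}(|t|)`, summed over the jump points `d` of `φ_E`. -/
noncomputable def tauFun (E : Set (ℝ × ℝ)) (t : ℝ) : ℝ≥0∞ :=
  ∑' d : jumpSet E, (Ioi (d : ℝ)).indicator (fun _ => jumpSize E d) |t|

/-- The horizontal rearrangement
`E★ = {(x, y) : φ_E(y) < ∞, 0 < x - φ_E(y) + τ_E(y) < λ_E(y)}`. -/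
noncomputable def rearrangement (E : Set (ℝ × ℝ)) : Set (ℝ × ℝ) :=
  {p | phiFun E p.2 ≠ ⊤ ∧
    0 < p.1 - (phiFun E p.2).toReal + (tauFun E p.2).toReal ∧
    ENNReal.ofReal (p.1 - (phiFun E p.2).toReal + (tauFun E p.2).toReal) < lambdaFun E p.2}

/-- The point of the graph of `h` over `s`, in the orthonormal coordinates obtained by rotating the
standard ones by the angle `θ`. -/
noncomputable def rotatedGraphPoint (θ : ℝ) (h : ℝ → ℝ) (s : ℝ) : ℝ × ℝ :=
  (Real.cos θ * s - Real.sin θ * h s, Real.sin θ * s + Real.cos θ * h s)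

/-- A planar set is piecewise Lipschitz if it is the union of finitely many graphs of Lipschitz
functions over compact intervals, each in some rotated orthonormal system of coordinates, two
different graphs having at most common endpoints in common. -/
def IsPiecewiseLipschitz (Γ : Set (ℝ × ℝ)) : Prop :=
  ∃ (n : ℕ) (θ a b : Fin n → ℝ) (h : Fin n → ℝ → ℝ) (K : ℝ≥0),
    (∀ i, a i < b i) ∧
    (∀ i, LipschitzOnWith K (h i) (Icc (a i) (b i))) ∧
    Γ = ⋃ i, rotatedGraphPoint (θ i) (h i) '' Icc (a i) (b i) ∧
    ∀ i j, i ≠ j →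
      rotatedGraphPoint (θ i) (h i) '' Icc (a i) (b i) ∩
          rotatedGraphPoint (θ j) (h j) '' Icc (a j) (b j) ⊆
        rotatedGraphPoint (θ i) (h i) '' {a i, b i} ∩
          rotatedGraphPoint (θ j) (h j) '' {a j, b j}

/-!
Both assertions reduce to one statement about plane regions: if `l` is nondecreasing and `r` is
nonincreasing on `[0, M)`, `l < r`, and both are right-continuous at `0`, then the region
`{|y| < M, l(|y|) < x < r(|y|)}` is bounded, and its frontier consists of four arcs, the graphs of
`l` and `r` with their jumps filled in and their mirror images in the horizontal axis. A filled
monotone graph is a chain for the product order, hence the graph of a `1`-Lipschitz function after a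
rotation by `π / 4` (`isLipschitzArc_of_chain`, `isLipschitzArc_filledGraph`,
`IsMonotoneRegion.isPiecewiseLipschitz_frontier`).

A Schwarz symmetric set `E` is `{|y| < u(x)}` for a function `u ≥ 0`. Testing the perimeter with the
fields `(a(x), 0)` shows that `u` has bounded variation after a change on a null set; since `u`
vanishes on the negative axis it is therefore essentially bounded, and it may be represented by a
function that is continuous off a countable set. Testing with the fields `(0, b(y))` shows that
`{u > 0}` has finite measure (`exists_isProfile`).

If `E` is `x`-convex, the end points `l`, `r` of its horizontal sections, the open intervals
`{u > t}`, are monotone in `t`, and the region statement applies to `E` itself.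

In general, let `g(x)` be the essential supremum of `u` on `(-∞, x)`. For `t > 0` one has
`φ_E(t) = |{x ≥ 0 : g < t}|` and `λ_E(t) = |{u ≥ t}|`, and at a level `d > 0` with `φ_E(d)` finite
the jump is `j_d = (|{g = d}| - |{u = d}|)⁺`. The end points of the sections of `E★` are `φ_E - τ_E`
and `φ_E - τ_E + λ_E`. The increment of `φ_E` over `[s, t)` is the length of `{s ≤ g < t}`. It is
at least that of `τ_E`, because `j_d ≤ |{g = d}|`; hence `φ_E - τ_E` is nondecreasing. It is at most
the increment of `τ_E` plus the decrease `|{s ≤ u < t}|` of `λ_E`: on a flat piece `{g = d}` of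
positive length this is the definition of `j_d`, and almost everywhere else `u = g`, because `u` is
continuous off a null set (`IsProfile.ae_eq_leftEssSup`). Hence `φ_E - τ_E + λ_E` is nonincreasing
(`IsProfile.exists_increments`), and the region statement applies to `E★`.
-/

/-! ### Lipschitz arcs -/

/-- `Γ` is an arc that is, in a rotated orthonormal system of coordinates, the graph of a Lipschitz
function over a nondegenerate compact interval; `e` is the set of its two endpoints. -/
def IsLipschitzArc (Γ e : Set (ℝ × ℝ)) : Prop :=
  ∃ (θ a b : ℝ) (h : ℝ → ℝ) (K : ℝ≥0), a < b ∧ LipschitzOnWith K h (Icc a b) ∧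
    Γ = rotatedGraphPoint θ h '' Icc a b ∧ e = rotatedGraphPoint θ h '' {a, b}

lemma isPiecewiseLipschitz_iUnion {n : ℕ} (Γ e : Fin n → Set (ℝ × ℝ))
    (harc : ∀ i, IsLipschitzArc (Γ i) (e i)) (hdisj : ∀ i j, i ≠ j → Γ i ∩ Γ j ⊆ e i ∩ e j) :
    IsPiecewiseLipschitz (⋃ i, Γ i) := by
  choose θ a b h K hab hlip hΓ he using harc
  refine ⟨n, θ, a, b, h, Finset.univ.sup K, hab, fun i => ?_, iUnion_congr hΓ, fun i j hij => ?_⟩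
  · exact (hlip i).weaken (Finset.le_sup (Finset.mem_univ i))
  · rw [← hΓ, ← hΓ, ← he, ← he]
    exact hdisj i j hij

lemma isPiecewiseLipschitz_empty : IsPiecewiseLipschitz ∅ :=
  ⟨0, Fin.elim0, Fin.elim0, Fin.elim0, Fin.elim0, 0, fun i => i.elim0, fun i => i.elim0,
    by simp, fun i => i.elim0⟩

/-- The reflection of the plane across the horizontal axis. -/
def reflectY (p : ℝ × ℝ) : ℝ × ℝ := (p.1, -p.2)

/-- The reflection of the plane across the vertical axis. -/
def reflectX (p : ℝ × ℝ) : ℝ × ℝ := (-p.1, p.2)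

lemma IsLipschitzArc.reflectY {Γ e : Set (ℝ × ℝ)} (hΓ : IsLipschitzArc Γ e) :
    IsLipschitzArc (reflectY ⁻¹' Γ) (reflectY ⁻¹' e) := by
  obtain ⟨θ, a, b, h, K, hab, hlip, rfl, rfl⟩ := hΓ
  have key (s : Set ℝ) : _root_.reflectY ⁻¹' (rotatedGraphPoint θ h '' s) =
      rotatedGraphPoint (-θ) (fun t => - h t) '' s := by
    ext ⟨x, y⟩
    simp only [_root_.reflectY, mem_preimage, mem_image, rotatedGraphPoint, Prod.mk.injEq,
      Real.cos_neg, Real.sin_neg]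
    refine exists_congr fun t => and_congr_right fun _ => ?_
    constructor <;> rintro ⟨h1, h2⟩ <;> constructor <;> linarith
  exact ⟨-θ, a, b, fun t => - h t, K, hab, hlip.neg, key _, key _⟩

lemma IsLipschitzArc.reflectX {Γ e : Set (ℝ × ℝ)} (hΓ : IsLipschitzArc Γ e) :
    IsLipschitzArc (reflectX ⁻¹' Γ) (reflectX ⁻¹' e) := by
  obtain ⟨θ, a, b, h, K, hab, hlip, rfl, rfl⟩ := hΓ
  have key (s : Set ℝ) : _root_.reflectX ⁻¹' (rotatedGraphPoint θ h '' s) =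
      rotatedGraphPoint (-θ) (fun t => h (-t)) '' ((fun t => -t) ⁻¹' s) := by
    ext ⟨x, y⟩
    simp only [_root_.reflectX, mem_preimage, mem_image, rotatedGraphPoint, Prod.mk.injEq,
      Real.cos_neg, Real.sin_neg]
    constructor
    · rintro ⟨t, ht, h1, h2⟩
      refine ⟨-t, by simpa using ht, ?_, ?_⟩ <;> rw [neg_neg] <;> linarith
    · rintro ⟨t, ht, h1, h2⟩
      exact ⟨-t, ht, by linarith, by linarith⟩
  refine ⟨-θ, -b, -a, fun t => h (-t), K, neg_lt_neg hab, ?_, ?_, ?_⟩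
  · have h1 : LipschitzOnWith 1 (fun t : ℝ => -t) (Icc (-b) (-a)) :=
      (LipschitzWith.id.neg).lipschitzOnWith
    have := hlip.comp h1 (fun t ht => ⟨by linarith [ht.2], by linarith [ht.1]⟩)
    rwa [mul_one] at this
  · rw [key]
    congr 1
    ext t
    simp only [mem_preimage, mem_Icc]
    constructor <;> rintro ⟨h1, h2⟩ <;> constructor <;> linarith
  · rw [key]
    congr 1
    ext t
    simp only [mem_preimage, mem_insert_iff, mem_singleton_iff, neg_eq_iff_eq_neg]
    exact or_comm

/-- A chain for the product order on which the sum of the coordinates takes all values between those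
at its smallest point `p` and its largest point `q` is a Lipschitz arc: in coordinates rotated by
`π / 4` the order makes it the graph of a `1`-Lipschitz function. -/
lemma isLipschitzArc_of_chain {L : Set (ℝ × ℝ)} {p q : ℝ × ℝ} (hp : p ∈ L) (hq : q ∈ L)
    (hpq : p.1 + p.2 < q.1 + q.2) (hchain : ∀ z ∈ L, ∀ w ∈ L, z ≤ w ∨ w ≤ z)
    (hL : ∀ z ∈ L, p ≤ z ∧ z ≤ q)
    (hsurj : ∀ w ∈ Icc (p.1 + p.2) (q.1 + q.2), ∃ z ∈ L, z.1 + z.2 = w) :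
    IsLipschitzArc L {p, q} := by
  set c : ℝ := √2 / 2 with hc
  have hc0 : 0 < c := by positivity
  have hcc : c * c = 1 / 2 := by
    rw [hc, div_mul_div_comm, Real.mul_self_sqrt (by norm_num)]; norm_num
  have huniq : ∀ z ∈ L, ∀ w ∈ L, z.1 + z.2 = w.1 + w.2 → z = w := by
    intro z hz w hw hzw
    rcases hchain z hz w hw with h | h
    · have h1 := h.1; have h2 := h.2
      exact Prod.ext (by linarith) (by linarith)
    · have h1 := h.1; have h2 := h.2
      exact Prod.ext (by linarith) (by linarith)
  have hsurj' : ∀ s : ℝ, ∃ z : ℝ × ℝ, s ∈ Icc ((p.1 + p.2) * c) ((q.1 + q.2) * c) →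
      z ∈ L ∧ c * (z.1 + z.2) = s := by
    intro s
    by_cases hs : s ∈ Icc ((p.1 + p.2) * c) ((q.1 + q.2) * c)
    · obtain ⟨z, hz, hzs⟩ := hsurj (s / c)
        ⟨(le_div_iff₀ hc0).2 hs.1, (div_le_iff₀ hc0).2 hs.2⟩
      exact ⟨z, fun _ => ⟨hz, by rw [hzs]; field_simp⟩⟩
    · exact ⟨0, fun h => absurd h hs⟩
  choose Z hZ using hsurj'
  have hrot : ∀ s ∈ Icc ((p.1 + p.2) * c) ((q.1 + q.2) * c),
      rotatedGraphPoint (Real.pi / 4) (fun s => c * ((Z s).2 - (Z s).1)) s = Z s := by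
    intro s hs
    have h2 := (hZ s hs).2
    rw [rotatedGraphPoint, Real.cos_pi_div_four, Real.sin_pi_div_four, ← hc]
    refine Prod.ext ?_ ?_
    · simp only
      nth_rewrite 1 [← h2]
      linear_combination (2 * (Z s).1) * hcc
    · simp only
      nth_rewrite 1 [← h2]
      linear_combination (2 * (Z s).2) * hcc
  have hZL : ∀ z ∈ L, c * (z.1 + z.2) ∈ Icc ((p.1 + p.2) * c) ((q.1 + q.2) * c) ∧
      Z (c * (z.1 + z.2)) = z := by
    intro z hz
    have hmem : c * (z.1 + z.2) ∈ Icc ((p.1 + p.2) * c) ((q.1 + q.2) * c) := by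
      have h1 := (hL z hz).1.1; have h2 := (hL z hz).1.2
      have h3 := (hL z hz).2.1; have h4 := (hL z hz).2.2
      rw [mul_comm c]
      exact ⟨mul_le_mul_of_nonneg_right (by linarith) hc0.le,
        mul_le_mul_of_nonneg_right (by linarith) hc0.le⟩
    exact ⟨hmem, huniq _ (hZ _ hmem).1 _ hz (mul_left_cancel₀ hc0.ne' (hZ _ hmem).2)⟩
  have hpq' : (p.1 + p.2) * c < (q.1 + q.2) * c := mul_lt_mul_of_pos_right hpq hc0
  refine ⟨Real.pi / 4, (p.1 + p.2) * c, (q.1 + q.2) * c, fun s => c * ((Z s).2 - (Z s).1), 1, hpq',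
    ?_, ?_, ?_⟩
  · refine LipschitzOnWith.of_dist_le_mul fun s hs t ht => ?_
    rw [NNReal.coe_one, one_mul, Real.dist_eq, Real.dist_eq]
    have h1 := (hZ s hs).2
    have h2 := (hZ t ht).2
    have h12 : s - t = c * ((Z s).1 + (Z s).2 - ((Z t).1 + (Z t).2)) := by
      rw [mul_sub, h1, h2]
    rw [h12, ← mul_sub, abs_mul, abs_mul]
    refine mul_le_mul_of_nonneg_left ?_ (abs_nonneg c)
    rw [abs_le]
    rcases hchain _ (hZ s hs).1 _ (hZ t ht).1 with h | h
    · have h3 := h.1; have h4 := h.2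
      rw [abs_of_nonpos (by linarith)]
      constructor <;> linarith
    · have h3 := h.1; have h4 := h.2
      rw [abs_of_nonneg (by linarith)]
      constructor <;> linarith
  · ext z
    constructor
    · intro hz
      exact ⟨_, (hZL z hz).1, by rw [hrot _ (hZL z hz).1, (hZL z hz).2]⟩
    · rintro ⟨s, hs, rfl⟩
      rw [hrot s hs]
      exact (hZ s hs).1
  · rw [image_pair, hrot _ (left_mem_Icc.2 hpq'.le), hrot _ (right_mem_Icc.2 hpq'.le), mul_comm,
      (hZL p hp).2, mul_comm, (hZL q hq).2]

/-! ### Regions bounded by two monotone curves -/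

/-- The graph `x = l(y)`, `0 ≤ y < M`, of a nondecreasing function with its jumps filled in by
horizontal segments, and closed up by the horizontal segment from its end at height `M` to
`(c, M)`. -/
def filledGraph (l : ℝ → ℝ) (M c : ℝ) : Set (ℝ × ℝ) :=
  {p | 0 ≤ p.2 ∧ p.2 ≤ M ∧ l 0 ≤ p.1 ∧ p.1 ≤ c ∧
    ∀ s ∈ Ico 0 M, (s < p.2 → l s ≤ p.1) ∧ (p.2 < s → p.1 ≤ l s)}

lemma isLipschitzArc_filledGraph {l : ℝ → ℝ} {M c : ℝ} (hM : 0 < M)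
    (hl : MonotoneOn l (Ico 0 M)) (hlc : ∀ s ∈ Ico 0 M, l s ≤ c) :
    IsLipschitzArc (filledGraph l M c) {(l 0, 0), (c, M)} := by
  have h0 : (0 : ℝ) ∈ Ico 0 M := ⟨le_rfl, hM⟩
  have hl0 : ∀ s ∈ Ico 0 M, l 0 ≤ l s := fun s hs => hl h0 hs hs.1
  refine isLipschitzArc_of_chain ?_ ?_ ?_ ?_ ?_ ?_
  · exact ⟨le_rfl, hM.le, le_rfl, hlc 0 h0, fun s hs => ⟨fun h => absurd hs.1 (not_le.2 h),
      fun _ => hl0 s hs⟩⟩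
  · exact ⟨hM.le, le_rfl, hlc 0 h0, le_rfl, fun s hs => ⟨fun _ => hlc s hs,
      fun h => absurd hs.2 (not_lt.2 h.le)⟩⟩
  · simpa using add_lt_add_of_le_of_lt (hlc 0 h0) hM
  · have key : ∀ z ∈ filledGraph l M c, ∀ w ∈ filledGraph l M c, z.2 < w.2 → z ≤ w := by
      rintro z ⟨hz0, hzM, -, -, hz⟩ w ⟨hw0, hwM, -, -, hw⟩ hzw
      obtain ⟨s, hs1, hs2⟩ := exists_between hzw
      have hs : s ∈ Ico 0 M := ⟨hz0.trans hs1.le, hs2.trans_le hwM⟩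
      exact ⟨((hz s hs).2 hs1).trans ((hw s hs).1 hs2), hzw.le⟩
    intro z hz w hw
    rcases lt_trichotomy z.2 w.2 with h | h | h
    · exact Or.inl (key z hz w hw h)
    · rcases le_total z.1 w.1 with h' | h'
      · exact Or.inl ⟨h', h.le⟩
      · exact Or.inr ⟨h', h.ge⟩
    · exact Or.inr (key w hw z hz h)
  · exact fun z hz => ⟨⟨hz.2.2.1, hz.1⟩, ⟨hz.2.2.2.1, hz.2.1⟩⟩
  · simp only [add_zero]
    rintro w ⟨hw0, hw1⟩
    -- The height of the point with coordinate sum `w` inverts the increasing map `t ↦ l t + t`.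
    set T : Set ℝ := {t | t = 0 ∨ (t ∈ Ico 0 M ∧ l t + t ≤ w)} with hT
    have hT0 : (0 : ℝ) ∈ T := Or.inl rfl
    have hTM : ∀ t ∈ T, t ≤ M := by
      rintro t (rfl | ht)
      exacts [hM.le, ht.1.2.le]
    have hbdd : BddAbove T := ⟨M, hTM⟩
    have hnot : ∀ s ∈ Ico 0 M, sSup T < s → w < l s + s := by
      intro s hs h
      by_contra hcon
      exact absurd (le_csSup hbdd (Or.inr ⟨hs, not_lt.1 hcon⟩)) (not_le.2 h)
    have hy0 : 0 ≤ sSup T := le_csSup hbdd hT0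
    have hyM : sSup T ≤ M := csSup_le ⟨0, hT0⟩ hTM
    refine ⟨(w - sSup T, sSup T), ⟨hy0, hyM, ?_, ?_, fun s hs => ⟨fun h => ?_, fun h => ?_⟩⟩,
      by simp⟩
    · have : sSup T ≤ w - l 0 := by
        refine csSup_le ⟨0, hT0⟩ ?_
        rintro t (rfl | ht)
        · linarith
        · linarith [hl0 t ht.1, ht.2]
      simp only
      linarith
    · by_contra hcon
      simp only [not_le] at hcon
      obtain ⟨t, ht1, ht2⟩ := exists_between (show sSup T < min M (w - c) from
        lt_min (by linarith) (by linarith))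
      have ht : t ∈ Ico 0 M := ⟨hy0.trans ht1.le, ht2.trans_le (min_le_left _ _)⟩
      have := hnot t ht ht1
      have := ht2.trans_le (min_le_right _ _)
      linarith [hlc t ht]
    · simp only at h ⊢
      obtain ⟨t, htT, hst⟩ := exists_lt_of_lt_csSup ⟨0, hT0⟩ h
      have ht : t ∈ Ico 0 M ∧ l t + t ≤ w := by
        rcases htT with rfl | ht
        · exact absurd hs.1 (not_le.2 hst)
        · exact ht
      have : sSup T ≤ w - l s := by
        refine csSup_le ⟨0, hT0⟩ fun t' ht' => ?_
        rcases le_or_gt t' s with h' | h'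
        · linarith [hl hs ht.1 hst.le, ht.2]
        · rcases ht' with rfl | ht'
          · exact absurd hs.1 (not_le.2 h')
          · linarith [hl hs ht'.1 h'.le, ht'.2]
      linarith
    · simp only at h ⊢
      have : w - l s ≤ sSup T := by
        refine le_of_forall_gt_imp_ge_of_dense fun s' hs' => ?_
        rcases le_or_gt s s' with h' | h'
        · linarith [hnot s hs h]
        · have hs'M : s' ∈ Ico 0 M := ⟨hy0.trans hs'.le, h'.trans hs.2⟩
          linarith [hnot s' hs'M hs', hl hs'M hs h'.le]
      linarith

/-- `F` is the region `{|y| < M, l(|y|) < x < r(|y|)}` between a nondecreasing function `l` and a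
nonincreasing function `r` that are right-continuous at `0`, up to an arbitrary part of the horizontal
segments that close the region at the heights `±M`. -/
structure IsMonotoneRegion (F : Set (ℝ × ℝ)) (l r : ℝ → ℝ) (M : ℝ) : Prop where
  pos : 0 < M
  mono : MonotoneOn l (Ico 0 M)
  anti : AntitoneOn r (Ico 0 M)
  lt : ∀ s ∈ Ico 0 M, l s < r s
  le_zero : ∀ x, (∀ s ∈ Ioo 0 M, x ≤ l s) → x ≤ l 0
  zero_le : ∀ x, (∀ s ∈ Ioo 0 M, r s ≤ x) → r 0 ≤ x
  mem_iff : ∀ x y, |y| < M → ((x, y) ∈ F ↔ l |y| < x ∧ x < r |y|)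
  abs_snd_le : ∀ x y, (x, y) ∈ F → |y| ≤ M
  mem_top : ∀ x y, (x, y) ∈ F → |y| = M → ∀ s ∈ Ico 0 M, l s ≤ x ∧ x ≤ r s

namespace IsMonotoneRegion

variable {F : Set (ℝ × ℝ)} {l r : ℝ → ℝ} {M : ℝ}

lemma mem_Ico (h : IsMonotoneRegion F l r M) : (0 : ℝ) ∈ Ico 0 M := ⟨le_rfl, h.pos⟩

lemma lt_of_mem (h : IsMonotoneRegion F l r M) {s t : ℝ} (hs : s ∈ Ico 0 M) (ht : t ∈ Ico 0 M) :
    l s < r t := by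
  rcases le_total s t with hst | hst
  · exact (h.mono hs ht hst).trans_lt (h.lt t ht)
  · exact (h.lt s hs).trans_le (h.anti ht hs hst)

lemma mem_closure_iff (h : IsMonotoneRegion F l r M) (x y : ℝ) :
    (x, y) ∈ closure F ↔ |y| ≤ M ∧ l 0 ≤ x ∧ x ≤ r 0 ∧
      ∀ s ∈ Ico 0 M, s < |y| → l s ≤ x ∧ x ≤ r s := by
  have h0 := h.mem_Ico
  constructor
  · set C : Set (ℝ × ℝ) := {p | |p.2| ≤ M} ∩ {p | l 0 ≤ p.1} ∩ {p | p.1 ≤ r 0} ∩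
      ⋂ s ∈ Ico 0 M, ({p | |p.2| ≤ s} ∪ ({p | l s ≤ p.1} ∩ {p | p.1 ≤ r s})) with hC
    have hclosed : IsClosed C := by
      have habs : Continuous fun p : ℝ × ℝ => |p.2| := continuous_snd.abs
      refine ((((isClosed_le habs continuous_const).inter
        (isClosed_le continuous_const continuous_fst)).inter
        (isClosed_le continuous_fst continuous_const))).inter
        (isClosed_biInter fun s _ => ?_)
      exact (isClosed_le habs continuous_const).union
        ((isClosed_le continuous_const continuous_fst).inter
          (isClosed_le continuous_fst continuous_const))
    have hsub : F ⊆ C := by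
      rintro ⟨x, y⟩ hxy
      have hy := h.abs_snd_le x y hxy
      have key : ∀ s ∈ Ico 0 M, s ≤ |y| → l s ≤ x ∧ x ≤ r s := by
        intro s hs hsy
        rcases hy.lt_or_eq with hy' | hy'
        · have hyM : |y| ∈ Ico 0 M := ⟨abs_nonneg y, hy'⟩
          have := (h.mem_iff x y hy').1 hxy
          exact ⟨(h.mono hs hyM hsy).trans this.1.le, this.2.le.trans (h.anti hs hyM hsy)⟩
        · exact h.mem_top x y hxy hy' s hs
      refine ⟨⟨⟨hy, (key 0 h0 (abs_nonneg y)).1⟩, (key 0 h0 (abs_nonneg y)).2⟩, ?_⟩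
      simp only [mem_iInter]
      intro s hs
      rcases le_or_gt |y| s with h' | h'
      · exact Or.inl h'
      · exact Or.inr (key s hs h'.le)
    intro hxy
    obtain ⟨⟨⟨h1, h2⟩, h3⟩, h4⟩ := hclosed.closure_subset_iff.2 hsub hxy
    refine ⟨h1, h2, h3, fun s hs hsy => ?_⟩
    simp only [mem_iInter] at h4
    rcases h4 s hs with h5 | h5
    · exact absurd hsy (not_lt.2 h5)
    · exact h5
  · rintro ⟨h1, h2, h3, h4⟩
    -- Move the point horizontally into the section at a slightly smaller height.
    have key : ∀ s ∈ Ico 0 M, l s ≤ x → x ≤ r s → ∀ ε > 0, ∃ x', |x' - x| < ε ∧ l s < x' ∧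
        x' < r s := by
      intro s hs hl hr ε hε
      have hlr := h.lt s hs
      obtain ⟨x', hx1, hx2⟩ := exists_between
        (show max (l s) (x - ε) < min (r s) (x + ε) from
          max_lt (lt_min hlr (by linarith)) (lt_min (by linarith) (by linarith)))
      rw [max_lt_iff] at hx1
      rw [lt_min_iff] at hx2
      exact ⟨x', abs_lt.2 ⟨by linarith, by linarith⟩, hx1.1, hx2.1⟩
    rw [Metric.mem_closure_iff]
    intro ε hε
    rcases eq_or_ne y 0 with rfl | hy
    · obtain ⟨x', hx, hl, hr⟩ := key 0 h0 h2 h3 ε hε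
      refine ⟨(x', 0), (h.mem_iff x' 0 (by simpa using h.pos)).2 (by simpa using ⟨hl, hr⟩), ?_⟩
      rw [Prod.dist_eq, dist_self, max_eq_left dist_nonneg, dist_comm, Real.dist_eq]
      exact hx
    · obtain ⟨s, hs1, hs2⟩ := exists_between (show max 0 (|y| - ε) < |y| from
        max_lt (abs_pos.2 hy) (by linarith))
      rw [max_lt_iff] at hs1
      have hs : s ∈ Ico 0 M := ⟨hs1.1.le, hs2.trans_le h1⟩
      obtain ⟨x', hx, hl, hr⟩ := key s hs (h4 s hs hs2).1 (h4 s hs hs2).2 ε hε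
      obtain ⟨y', hy', hyy'⟩ : ∃ y', |y'| = s ∧ |y' - y| < ε := by
        rcases lt_or_gt_of_ne hy with hneg | hpos
        · rw [abs_of_neg hneg] at hs1 hs2
          exact ⟨-s, by rw [abs_neg, abs_of_pos hs1.1], abs_lt.2 ⟨by linarith, by linarith⟩⟩
        · rw [abs_of_pos hpos] at hs1 hs2
          exact ⟨s, abs_of_pos hs1.1, abs_lt.2 ⟨by linarith, by linarith⟩⟩
      refine ⟨(x', y'), (h.mem_iff x' y' (by rw [hy']; exact hs.2)).2 (by rw [hy']; exact ⟨hl, hr⟩),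
        ?_⟩
      rw [Prod.dist_eq, dist_comm, dist_comm y, Real.dist_eq, Real.dist_eq]
      exact max_lt hx hyy'

lemma mem_interior_iff (h : IsMonotoneRegion F l r M) (x y : ℝ) :
    (x, y) ∈ interior F ↔ ∃ s ∈ Ico 0 M, |y| < s ∧ l s < x ∧ x < r s := by
  constructor
  · intro hxy
    obtain ⟨ε, hε, hball⟩ := Metric.isOpen_iff.1 isOpen_interior _ hxy
    obtain ⟨y', hy', hyy'⟩ : ∃ y', |y'| = |y| + ε / 2 ∧ |y' - y| < ε := by
      rcases lt_or_ge y 0 with hneg | hpos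
      · exact ⟨y - ε / 2, by rw [abs_of_neg hneg, abs_of_neg (by linarith)]; ring,
          abs_lt.2 ⟨by linarith, by linarith⟩⟩
      · exact ⟨y + ε / 2, by rw [abs_of_nonneg hpos, abs_of_nonneg (by linarith)],
          abs_lt.2 ⟨by linarith, by linarith⟩⟩
    have hmem : (x, y') ∈ interior F := hball (by
      rw [Metric.mem_ball, Prod.dist_eq, dist_self, Real.dist_eq]
      exact max_lt hε hyy')
    have hlt : |y'| < M := by
      refine lt_of_le_of_ne (h.abs_snd_le x y' (interior_subset hmem)) fun heq => ?_
      -- A point at height `M` has points of height larger than `M` near it.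
      obtain ⟨δ, hδ, hball'⟩ := Metric.isOpen_iff.1 isOpen_interior _ hmem
      obtain ⟨z, hz, hzz⟩ : ∃ z, |z| = |y'| + δ / 2 ∧ |z - y'| < δ := by
        rcases lt_or_ge y' 0 with hneg | hpos
        · exact ⟨y' - δ / 2, by rw [abs_of_neg hneg, abs_of_neg (by linarith)]; ring,
            abs_lt.2 ⟨by linarith, by linarith⟩⟩
        · exact ⟨y' + δ / 2, by rw [abs_of_nonneg hpos, abs_of_nonneg (by linarith)],
            abs_lt.2 ⟨by linarith, by linarith⟩⟩
      have hmem' : (x, z) ∈ interior F := hball' (by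
        rw [Metric.mem_ball, Prod.dist_eq, dist_self, Real.dist_eq]
        exact max_lt hδ hzz)
      linarith [h.abs_snd_le x z (interior_subset hmem')]
    exact ⟨|y'|, ⟨abs_nonneg _, hlt⟩, by linarith,
      (h.mem_iff x y' hlt).1 (interior_subset hmem)⟩
  · rintro ⟨s, hs, hys, hl, hr⟩
    refine mem_interior.2 ⟨{p | |p.2| < s} ∩ {p | l s < p.1} ∩ {p | p.1 < r s}, ?_, ?_,
      ⟨⟨hys, hl⟩, hr⟩⟩
    · rintro ⟨x', y'⟩ ⟨⟨h1, h2⟩, h3⟩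
      simp only [mem_ofPred_eq] at h1 h2 h3
      have hy' : |y'| ∈ Ico 0 M := ⟨abs_nonneg _, h1.trans hs.2⟩
      exact (h.mem_iff x' y' hy'.2).2 ⟨(h.mono hy' hs h1.le).trans_lt h2,
        h3.trans_le (h.anti hy' hs h1.le)⟩
    · exact ((isOpen_lt continuous_snd.abs continuous_const).inter
        (isOpen_lt continuous_const continuous_fst)).inter
        (isOpen_lt continuous_fst continuous_const)

lemma isBounded (h : IsMonotoneRegion F l r M) : Bornology.IsBounded F := by
  refine ((Metric.isBounded_Icc (l 0) (r 0)).prod (Metric.isBounded_Icc (-M) M)).subset ?_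
  rintro ⟨x, y⟩ hxy
  have := (h.mem_closure_iff x y).1 (subset_closure hxy)
  exact ⟨⟨this.2.1, this.2.2.1⟩, abs_le.1 this.1⟩

/-- The upper half of the frontier consists of the filled graphs of `l` and `r`. The parameter `c` is
the abscissa of the point of the top segment at which the two arcs are cut. -/
lemma mem_frontier_iff (h : IsMonotoneRegion F l r M) {c : ℝ}
    (hc : ∀ s ∈ Ico 0 M, l s ≤ c ∧ c ≤ r s) (x y : ℝ) :
    (x, y) ∈ frontier F ↔ (x, |y|) ∈ filledGraph l M c ∨
      (-x, |y|) ∈ filledGraph (fun s => -r s) M (-c) := by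
  have h0 := h.mem_Ico
  rw [frontier, Set.mem_sdiff, h.mem_closure_iff, h.mem_interior_iff]
  simp only [filledGraph, mem_ofPred_eq, neg_le_neg_iff, not_exists, not_and, not_lt]
  have hy := abs_nonneg y
  constructor
  · rintro ⟨⟨h1, h2, h3, h4⟩, h5⟩
    by_cases hx : ∀ s ∈ Ico 0 M, |y| < s → x ≤ l s
    · rcases le_or_gt x c with hxc | hxc
      · exact Or.inl ⟨hy, h1, h2, hxc, fun s hs => ⟨fun h' => (h4 s hs h').1, hx s hs⟩⟩
      · refine Or.inr ⟨hy, h1, h3, hxc.le, fun s hs => ⟨fun h' => (h4 s hs h').2, fun h' => ?_⟩⟩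
        linarith [hx s hs h', (hc s hs).1]
    · push Not at hx
      obtain ⟨s, hs, hys, hls⟩ := hx
      have hr : ∀ t ∈ Ico 0 M, |y| < t → r t ≤ x := by
        intro t ht hyt
        refine h5 t ht hyt ?_
        rcases le_total t s with hts | hts
        · exact (h.mono ht hs hts).trans_lt hls
        · by_contra hcon
          have := h.lt_of_mem ht ht
          have := h.anti hs ht hts
          linarith [h5 s hs hys hls]
      exact Or.inr ⟨hy, h1, h3, (hc s hs).2.trans (hr s hs hys),
        fun s hs => ⟨fun h' => (h4 s hs h').2, hr s hs⟩⟩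
  · rintro (⟨-, h1, h2, h3, h4⟩ | ⟨-, h1, h2, h3, h4⟩)
    · exact ⟨⟨h1, h2, h3.trans (hc 0 h0).2, fun s hs hsy => ⟨(h4 s hs).1 hsy,
        h3.trans (hc s hs).2⟩⟩, fun s hs hys hls => absurd ((h4 s hs).2 hys) (not_le.2 hls)⟩
    · exact ⟨⟨h1, (hc 0 h0).1.trans h3, h2, fun s hs hsy => ⟨(hc s hs).1.trans h3,
        (h4 s hs).1 hsy⟩⟩, fun s hs hys _ => (h4 s hs).2 hys⟩

lemma isPiecewiseLipschitz_frontier (h : IsMonotoneRegion F l r M) :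
    IsPiecewiseLipschitz (frontier F) := by
  have h0 := h.mem_Ico
  obtain ⟨c, hc⟩ : ∃ c, ∀ s ∈ Ico 0 M, l s ≤ c ∧ c ≤ r s := by
    have hbdd : BddAbove (l '' Ico 0 M) := by
      refine ⟨r 0, ?_⟩
      rintro _ ⟨t, ht, rfl⟩
      exact (h.lt_of_mem ht h0).le
    refine ⟨sSup (l '' Ico 0 M), fun s hs => ⟨le_csSup hbdd (mem_image_of_mem _ hs),
      csSup_le ⟨_, mem_image_of_mem _ hs⟩ ?_⟩⟩
    rintro _ ⟨t, ht, rfl⟩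
    exact (h.lt_of_mem ht hs).le
  set L := filledGraph l M c with hL
  set R := reflectX ⁻¹' filledGraph (fun s => -r s) M (-c) with hR
  have hLarc : IsLipschitzArc L {(l 0, 0), (c, M)} :=
    isLipschitzArc_filledGraph h.pos h.mono fun s hs => (hc s hs).1
  have hRarc : IsLipschitzArc R {(r 0, 0), (c, M)} := by
    convert (isLipschitzArc_filledGraph (c := -c) h.pos h.anti.neg
      fun s hs => neg_le_neg (hc s hs).2).reflectX using 1
    ext ⟨x, y⟩
    simp [reflectX]
  have hLR : L ∩ R ⊆ {(c, M)} := by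
    rintro ⟨x, y⟩ ⟨⟨hy0, hyM, -, hxc, hx⟩, ⟨-, -, -, hxc', hx'⟩⟩
    simp only [reflectX, neg_le_neg_iff] at hy0 hyM hxc hx hxc' hx'
    have hy : y = M := by
      refine hyM.antisymm (not_lt.1 fun hlt => ?_)
      obtain ⟨s, hs1, hs2⟩ := exists_between hlt
      have hs : s ∈ Ico 0 M := ⟨hy0.trans hs1.le, hs2⟩
      linarith [(hx s hs).2 hs1, (hx' s hs).2 hs1, h.lt s hs]
    rw [hy, le_antisymm hxc hxc']
    rfl
  have hL0 : ∀ p ∈ L, p.2 = 0 → p = (l 0, 0) := by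
    rintro ⟨x, y⟩ ⟨-, -, hx0, -, hx⟩ rfl
    exact Prod.ext (le_antisymm (h.le_zero x fun s hs => (hx s ⟨hs.1.le, hs.2⟩).2 hs.1) hx0) rfl
  have hR0 : ∀ p ∈ R, p.2 = 0 → p = (r 0, 0) := by
    rintro ⟨x, y⟩ ⟨-, -, hx0, -, hx⟩ rfl
    simp only [reflectX, neg_le_neg_iff] at hx0 hx
    exact Prod.ext (le_antisymm hx0
      (h.zero_le x fun s hs => (hx s ⟨hs.1.le, hs.2⟩).2 hs.1)) rfl
  have hL2 : ∀ p ∈ L, 0 ≤ p.2 := fun p hp => hp.1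
  have hR2 : ∀ p ∈ R, 0 ≤ p.2 := fun p hp => hp.1
  have hdisj : ∀ p ∈ L, p ∈ R → p.2 ≠ 0 := by
    intro p hpL hpR hp
    have := hLR ⟨hpL, hpR⟩
    rw [mem_singleton_iff] at this
    rw [this] at hp
    exact h.pos.ne' hp
  have hfr : frontier F = ⋃ i : Fin 4, ![L, R, reflectY ⁻¹' L, reflectY ⁻¹' R] i := by
    ext ⟨x, y⟩
    rw [h.mem_frontier_iff hc]
    simp only [mem_iUnion, Fin.exists_fin_succ, Matrix.cons_val_zero, Matrix.cons_val_succ,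
      IsEmpty.exists_iff, or_false, mem_preimage, reflectY]
    change (x, |y|) ∈ L ∨ (x, |y|) ∈ R ↔ _
    rcases le_total 0 y with hy | hy
    · rw [abs_of_nonneg hy]
      refine ⟨fun h' => h'.elim Or.inl fun h'' => Or.inr (Or.inl h''), ?_⟩
      rintro (h' | h' | h' | h')
      · exact Or.inl h'
      · exact Or.inr h'
      · have := hL2 _ h'
        obtain rfl : y = 0 := by simp only at this; linarith
        exact Or.inl (by simpa using h')
      · have := hR2 _ h'
        obtain rfl : y = 0 := by simp only at this; linarith
        exact Or.inr (by simpa using h')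
    · rw [abs_of_nonpos hy]
      refine ⟨fun h' => Or.inr (Or.inr h'), ?_⟩
      rintro (h' | h' | h')
      · have := hL2 _ h'
        obtain rfl : y = 0 := by simp only at this; linarith
        exact Or.inl (by simpa using h')
      · have := hR2 _ h'
        obtain rfl : y = 0 := by simp only at this; linarith
        exact Or.inr (by simpa using h')
      · exact h'
  rw [hfr]
  refine isPiecewiseLipschitz_iUnion _ ![{(l 0, 0), (c, M)}, {(r 0, 0), (c, M)},
    reflectY ⁻¹' {(l 0, 0), (c, M)}, reflectY ⁻¹' {(r 0, 0), (c, M)}] ?_ ?_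
  · intro i
    fin_cases i
    exacts [hLarc, hRarc, hLarc.reflectY, hRarc.reflectY]
  -- By symmetry it is enough to look at the pairs `i < j`.
  have hsymm : ∀ {A B a b : Set (ℝ × ℝ)}, A ∩ B ⊆ a ∩ b → B ∩ A ⊆ b ∩ a := by
    intro A B a b hAB
    rwa [inter_comm B, inter_comm b]
  have h01 : L ∩ R ⊆ {(l 0, 0), (c, M)} ∩ {(r 0, 0), (c, M)} := by
    intro p hp
    rw [hLR hp]
    exact ⟨Or.inr rfl, Or.inr rfl⟩
  have hzero : ∀ {A B : Set (ℝ × ℝ)}, (∀ p ∈ A, 0 ≤ p.2) → (∀ p ∈ B, 0 ≤ p.2) →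
      ∀ p ∈ A ∩ reflectY ⁻¹' B, p.2 = 0 ∧ p ∈ B := by
    rintro A B hA hB ⟨x, y⟩ ⟨hpA, hpB⟩
    have h1 := hA _ hpA
    have h2 := hB _ hpB
    simp only [reflectY] at h1 h2
    obtain rfl : y = 0 := by linarith
    exact ⟨rfl, by simpa [reflectY] using hpB⟩
  have h02 : L ∩ reflectY ⁻¹' L ⊆ {(l 0, 0), (c, M)} ∩ reflectY ⁻¹' {(l 0, 0), (c, M)} := by
    intro p hp
    rw [hL0 p hp.1 (hzero hL2 hL2 p hp).1]
    simp [reflectY]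
  have h13 : R ∩ reflectY ⁻¹' R ⊆ {(r 0, 0), (c, M)} ∩ reflectY ⁻¹' {(r 0, 0), (c, M)} := by
    intro p hp
    rw [hR0 p hp.1 (hzero hR2 hR2 p hp).1]
    simp [reflectY]
  have h03 : L ∩ reflectY ⁻¹' R ⊆ {(l 0, 0), (c, M)} ∩ reflectY ⁻¹' {(r 0, 0), (c, M)} :=
    fun p hp => absurd (hzero hL2 hR2 p hp).1 (hdisj p hp.1 (hzero hL2 hR2 p hp).2)
  have h12 : R ∩ reflectY ⁻¹' L ⊆ {(r 0, 0), (c, M)} ∩ reflectY ⁻¹' {(l 0, 0), (c, M)} :=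
    fun p hp => absurd (hzero hR2 hL2 p hp).1 (hdisj p (hzero hR2 hL2 p hp).2 hp.1)
  have h23 : reflectY ⁻¹' L ∩ reflectY ⁻¹' R ⊆
      reflectY ⁻¹' {(l 0, 0), (c, M)} ∩ reflectY ⁻¹' {(r 0, 0), (c, M)} :=
    fun p hp => h01 hp
  intro i j hij
  fin_cases i <;> fin_cases j
  exacts [absurd rfl hij, h01, h02, h03, hsymm h01, absurd rfl hij, h12, h13, hsymm h02, hsymm h12,
    absurd rfl hij, h23, hsymm h03, hsymm h13, hsymm h23, absurd rfl hij]

end IsMonotoneRegion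

/-! ### Functions of bounded variation on the line -/

open Filter Topology in
/-- An integrable function on the line whose distributional derivative has total mass at most `C`
agrees almost everywhere with a function of pointwise variation at most `C`: this is true of its
mollifications, which converge to it almost everywhere, and the variation is lower
semicontinuous. -/
lemma exists_eVariationOn_le {V : ℝ → ℝ} (hV : Integrable V) {C : ℝ}
    (h : ∀ a : ℝ → ℝ, ContDiff ℝ 1 a → HasCompactSupport a → (∀ t, |a t| ≤ 1) →
      ∫ t, deriv a t * V t ≤ C) :
    ∃ S : Set ℝ, (∀ᵐ x, x ∈ S) ∧ eVariationOn V S ≤ ENNReal.ofReal C := by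
  let φ : ℕ → ContDiffBump (0 : ℝ) := fun n =>
    ⟨(1 / ((n : ℝ) + 1)), 2 * (1 / ((n : ℝ) + 1)), by positivity, by
      have : 0 < 1 / ((n : ℝ) + 1) := by positivity
      linarith⟩
  set W : ℕ → ℝ → ℝ := fun n =>
    convolution ((φ n).normed volume) V (ContinuousLinearMap.lsmul ℝ ℝ) volume with hW
  have hlim : ∀ᵐ x, Tendsto (fun n => W n x) atTop (𝓝 (V x)) := by
    refine ContDiffBump.ae_convolution_tendsto_right_of_locallyIntegrable (K := 2) ?_ ?_
      hV.locallyIntegrable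
    · simpa [φ] using (tendsto_one_div_add_atTop_nhds_zero_nat (𝕜 := ℝ)).const_mul 2
    · exact Eventually.of_forall fun n => le_rfl
  refine ⟨{x | Tendsto (fun n => W n x) atTop (𝓝 (V x))}, hlim, ?_⟩
  have hvar : ∀ n, eVariationOn (W n) univ ≤ ENNReal.ofReal C := by
    intro n
    set ρ : ℝ → ℝ := (φ n).normed volume with hρ
    have hρc : Continuous ρ := (φ n).continuous_normed
    have hρ0 : ∀ t, 0 ≤ ρ t := fun t => (φ n).nonneg_normed t
    have hρ1 : ∫ t, ρ t = 1 := (φ n).integral_normed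
    have hρi : Integrable ρ := (φ n).integrable_normed
    have hρs : ∀ t, (φ n).rOut ≤ |t| → ρ t = 0 := by
      intro t ht
      have : t ∉ Function.support ρ := by
        rw [hρ, ContDiffBump.support_normed_eq, Metric.mem_ball, dist_zero_right]
        exact not_lt.2 ht
      simpa using this
    set R : ℝ → ℝ := fun z => ∫ t in (0 : ℝ)..z, ρ t with hR
    have hRd : ∀ z, HasDerivAt R (ρ z) z := fun z =>
      intervalIntegral.integral_hasDerivAt_right (hρc.intervalIntegrable _ _)
        (hρc.stronglyMeasurableAtFilter _ _) hρc.continuousAt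
    have hRsub : ∀ z w, R z - R w = ∫ t in w..z, ρ t := fun z w =>
      intervalIntegral.integral_interval_sub_left (hρc.intervalIntegrable _ _)
        (hρc.intervalIntegrable _ _)
    have hRmono : Monotone R := by
      intro z w hzw
      have := intervalIntegral.integral_nonneg (μ := volume) hzw fun t _ => hρ0 t
      rw [← hRsub] at this
      linarith
    have hRle : ∀ z w, w ≤ z → R z - R w ≤ 1 := by
      intro z w hwz
      rw [hRsub, intervalIntegral.integral_of_le hwz, ← hρ1]
      exact setIntegral_le_integral hρi (Eventually.of_forall hρ0)
    refine iSup_le fun ⟨m, x, hx, _⟩ => ?_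
    simp only
    set σ : ℕ → ℝ := fun i => if W n (x i) ≤ W n (x (i + 1)) then 1 else -1 with hσ
    have hσ1 : ∀ i, |σ i| = 1 := by
      intro i
      simp only [hσ]
      split_ifs <;> simp
    have hσabs : ∀ i, σ i * (W n (x (i + 1)) - W n (x i)) = |W n (x (i + 1)) - W n (x i)| := by
      intro i
      simp only [hσ]
      split_ifs with hi
      · rw [abs_of_nonneg (by linarith), one_mul]
      · rw [abs_of_neg (by linarith)]
        ring
    -- The test function: smoothed indicators of the intervals `[x i, x (i + 1)]` with signs.
    set a : ℝ → ℝ := fun t => ∑ i ∈ Finset.range m, σ i * (R (x i - t) - R (x (i + 1) - t)) with ha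
    have had : ∀ t, HasDerivAt a
        (∑ i ∈ Finset.range m, σ i * (ρ (x (i + 1) - t) - ρ (x i - t))) t := by
      intro t
      refine HasDerivAt.fun_sum fun i _ => HasDerivAt.const_mul _ ?_
      have key : ∀ c : ℝ, HasDerivAt (fun t => R (c - t)) (-ρ (c - t)) t := by
        intro c
        have := (hRd (c - t)).comp t ((hasDerivAt_id t).const_sub c)
        simpa [Function.comp_def] using this
      exact ((key (x i)).fun_sub (key (x (i + 1)))).congr_deriv (by ring)
    have hderiv : deriv a = fun t => ∑ i ∈ Finset.range m,
        σ i * (ρ (x (i + 1) - t) - ρ (x i - t)) := funext fun t => (had t).deriv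
    have haC : ContDiff ℝ 1 a := by
      rw [contDiff_one_iff_deriv]
      refine ⟨fun t => (had t).differentiableAt, ?_⟩
      rw [hderiv]
      fun_prop
    have hcs : HasCompactSupport a := by
      refine HasCompactSupport.intro (isCompact_Icc (a := x 0 - (φ n).rOut)
        (b := x m + (φ n).rOut)) fun t ht => ?_
      refine Finset.sum_eq_zero fun i hi => ?_
      have hi' := Finset.mem_range.1 hi
      rw [hRsub]
      suffices h0 : ∫ s in (x (i + 1) - t)..(x i - t), ρ s = 0 by rw [h0, mul_zero]
      have hx0 : x 0 ≤ x i := hx (Nat.zero_le _)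
      have hxm : x (i + 1) ≤ x m := hx hi'
      have hxi : x i ≤ x (i + 1) := hx (Nat.le_succ _)
      refine (intervalIntegral.integral_congr (g := fun _ => 0) fun s hs => ?_).trans (by simp)
      rw [uIcc_of_ge (by linarith)] at hs
      refine hρs s ?_
      rw [le_abs]
      by_contra hcon
      push Not at hcon
      exact ht ⟨by linarith [hs.2, hs.1], by linarith [hs.1, hs.2]⟩
    have hale : ∀ t, |a t| ≤ 1 := by
      intro t
      calc |a t| ≤ ∑ i ∈ Finset.range m, |σ i * (R (x i - t) - R (x (i + 1) - t))| :=
            Finset.abs_sum_le_sum_abs _ _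
        _ = ∑ i ∈ Finset.range m, (R (x (i + 1) - t) - R (x i - t)) := by
            refine Finset.sum_congr rfl fun i _ => ?_
            have := hRmono (show x i - t ≤ x (i + 1) - t by linarith [hx (Nat.le_succ i)])
            rw [abs_mul, hσ1, one_mul, abs_of_nonpos (by linarith)]
            ring
        _ = R (x m - t) - R (x 0 - t) := Finset.sum_range_sub (fun i => R (x i - t)) m
        _ ≤ 1 := hRle _ _ (by linarith [hx (Nat.zero_le m)])
    have hint : ∀ c : ℝ, Integrable fun t => ρ (c - t) * V t := by
      intro c
      obtain ⟨B, hB⟩ := hρc.bounded_above_of_compact_support (φ n).hasCompactSupport_normed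
      exact hV.bdd_mul (hρc.comp (continuous_const.sub continuous_id)).aestronglyMeasurable
        (Eventually.of_forall fun t => hB (c - t))
    have hWeq : ∀ c, W n c = ∫ t, ρ (c - t) * V t := by
      intro c
      simp only [hW, convolution_eq_swap, ContinuousLinearMap.lsmul_apply, smul_eq_mul, hρ]
    have hval : ∫ t, deriv a t * V t = ∑ i ∈ Finset.range m, |W n (x (i + 1)) - W n (x i)| := by
      have h1 : ∀ t, deriv a t * V t = ∑ i ∈ Finset.range m,
          σ i * (ρ (x (i + 1) - t) * V t - ρ (x i - t) * V t) := by
        intro t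
        rw [hderiv, Finset.sum_mul]
        exact Finset.sum_congr rfl fun i _ => by ring
      simp_rw [h1]
      have h2 : ∀ i ∈ Finset.range m, Integrable fun t =>
          σ i * (ρ (x (i + 1) - t) * V t - ρ (x i - t) * V t) :=
        fun i _ => ((hint _).sub (hint _)).const_mul _
      rw [integral_finsetSum _ h2]
      refine Finset.sum_congr rfl fun i _ => ?_
      rw [integral_const_mul, integral_sub (hint _) (hint _), ← hWeq, ← hWeq, hσabs]
    have hfin := h a haC hcs hale
    rw [hval] at hfin
    calc ∑ i ∈ Finset.range m, edist (W n (x (i + 1))) (W n (x i))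
        = ∑ i ∈ Finset.range m, ENNReal.ofReal |W n (x (i + 1)) - W n (x i)| :=
          Finset.sum_congr rfl fun i _ => by rw [edist_dist, Real.dist_eq]
      _ = ENNReal.ofReal (∑ i ∈ Finset.range m, |W n (x (i + 1)) - W n (x i)|) :=
          (ENNReal.ofReal_sum_of_nonneg fun i _ => abs_nonneg _).symm
      _ ≤ ENNReal.ofReal C := ENNReal.ofReal_le_ofReal hfin
  by_contra hcon
  obtain ⟨n, hn⟩ := (eVariationOn.lowerSemicontinuous_aux (F := W) (p := atTop)
    (fun x hx => hx) (not_le.1 hcon)).exists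
  exact absurd ((eVariationOn.mono (W n) (subset_univ _)).trans (hvar n)) (not_le.2 hn)

/-- A function of bounded variation on a set of full measure is almost everywhere the difference of
two nondecreasing functions on the line. -/
lemma exists_monotone_sub_of_eVariationOn_ne_top {V : ℝ → ℝ} {S : Set ℝ} (hS : ∀ᵐ x, x ∈ S)
    (hV : BoundedVariationOn V S) :
    ∃ p q : ℝ → ℝ, Monotone p ∧ Monotone q ∧ ∀ᵐ x, V x = p x - q x := by
  obtain ⟨a, ha⟩ : S.Nonempty := hS.exists
  have hloc := hV.locallyBoundedVariationOn
  have hfin : eVariationOn V S ≠ ⊤ := hV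
  have habs : ∀ x ∈ S, |variationOnFromTo V S a x| ≤ (eVariationOn V S).toReal := by
    intro x hx
    have key : ∀ s ⊆ S, (eVariationOn V s).toReal ≤ (eVariationOn V S).toReal := fun s hs =>
      ENNReal.toReal_mono hfin (eVariationOn.mono V hs)
    rw [variationOnFromTo]
    split_ifs
    · rw [abs_of_nonneg ENNReal.toReal_nonneg]
      exact key _ inter_subset_left
    · rw [abs_neg, abs_of_nonneg ENNReal.toReal_nonneg]
      exact key _ inter_subset_left
  have hVle : ∀ x ∈ S, |V x| ≤ |V a| + (eVariationOn V S).toReal := by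
    intro x hx
    have := hV.dist_le hx ha
    rw [Real.dist_eq] at this
    linarith [abs_sub_abs_le_abs_sub (V x) (V a)]
  have hbdd : ∀ (f : ℝ → ℝ) (C : ℝ), (∀ x ∈ S, |f x| ≤ C) →
      BddBelow (f '' S) ∧ BddAbove (f '' S) := by
    intro f C hf
    constructor
    · refine ⟨-C, ?_⟩
      rintro _ ⟨x, hx, rfl⟩
      exact (abs_le.1 (hf x hx)).1
    · refine ⟨C, ?_⟩
      rintro _ ⟨x, hx, rfl⟩
      exact (abs_le.1 (hf x hx)).2
  have hb1 := hbdd _ _ habs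
  have hb2 := hbdd (variationOnFromTo V S a - V)
    ((eVariationOn V S).toReal + (|V a| + (eVariationOn V S).toReal)) fun x hx =>
      (abs_sub _ _).trans (add_le_add (habs x hx) (hVle x hx))
  obtain ⟨p, hp, hpS⟩ :=
    (variationOnFromTo.monotoneOn hloc ha).exists_monotone_extension hb1.1 hb1.2
  obtain ⟨q, hq, hqS⟩ :=
    (variationOnFromTo.sub_self_monotoneOn hloc ha).exists_monotone_extension hb2.1 hb2.2
  refine ⟨p, q, hp, hq, ?_⟩
  filter_upwards [hS] with x hx
  rw [← hpS hx, ← hqS hx, Pi.sub_apply]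
  ring

/-! ### Sections and test fields -/

/-- A symmetric open interval is determined by its length. -/
lemma mem_iff_lt_volume_of_symmetric {A : Set ℝ} (hA : IsOpenInterval A) (hsymm : ∀ y ∈ A, -y ∈ A)
    (y : ℝ) : y ∈ A ↔ ENNReal.ofReal (2 * |y|) < volume A := by
  have habs : ∀ {y : ℝ}, y ∈ A → |y| ∈ A := by
    intro y hy
    rcases abs_choice y with h | h <;> rw [h]
    exacts [hy, hsymm y hy]
  have habs' : ∀ {y : ℝ}, |y| ∈ A → y ∈ A := by
    intro y hy
    rcases abs_choice y with h | h <;> rw [h] at hy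
    exacts [hy, by simpa using hsymm _ hy]
  constructor
  · intro hy
    obtain ⟨ε, hε, hball⟩ := Metric.isOpen_iff.1 hA.1 _ (habs hy)
    have hmem : |y| + ε / 2 ∈ A := hball (by
      rw [Metric.mem_ball, Real.dist_eq, add_sub_cancel_left, abs_of_pos (by linarith)]
      linarith)
    have hsub : Icc (-(|y| + ε / 2)) (|y| + ε / 2) ⊆ A := hA.2.out (hsymm _ hmem) hmem
    refine lt_of_lt_of_le ?_ (measure_mono hsub)
    rw [Real.volume_Icc]
    have := abs_nonneg y
    exact (ENNReal.ofReal_lt_ofReal_iff (by linarith)).2 (by linarith)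
  · intro h
    by_contra hy
    refine absurd h (not_lt.2 ?_)
    have hsub : A ⊆ Ioo (-|y|) |y| := by
      intro z hz
      rw [mem_Ioo, ← abs_lt]
      by_contra hcon
      have hz' := habs hz
      exact hy (habs' (hA.2.out (hsymm _ hz') hz'
        ⟨by linarith [abs_nonneg y, abs_nonneg z], not_lt.1 hcon⟩))
    refine (measure_mono hsub).trans ?_
    rw [Real.volume_Ioo]
    exact ENNReal.ofReal_le_ofReal (by linarith)

lemma integral_planeDiv_le_perimeter {E : Set (ℝ × ℝ)} (hper : perimeter E < ⊤)
    {X : ℝ × ℝ → ℝ × ℝ} (hX : ContDiff ℝ 1 X) (hXc : HasCompactSupport X)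
    (hX1 : ∀ p, Real.sqrt ((X p).1 ^ 2 + (X p).2 ^ 2) ≤ 1) :
    ∫ p in E, planeDiv X p ≤ (perimeter E).toReal := by
  refine (ENNReal.ofReal_le_iff_le_toReal hper.ne).1 ?_
  exact le_iSup_of_le X (le_iSup_of_le hX (le_iSup_of_le hXc (le_iSup_of_le hX1 le_rfl)))

section ProductFields

variable {a b : ℝ → ℝ}

lemma hasCompactSupport_mul_prod (hac : HasCompactSupport a) (hbc : HasCompactSupport b) :
    HasCompactSupport fun p : ℝ × ℝ => a p.1 * b p.2 := by
  refine HasCompactSupport.intro (hac.isCompact.prod hbc.isCompact) fun p hp => ?_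
  by_contra hcon
  exact hp ⟨subset_tsupport _ (left_ne_zero_of_mul hcon),
    subset_tsupport _ (right_ne_zero_of_mul hcon)⟩

lemma hasFDerivAt_mul_prod (ha : ContDiff ℝ 1 a) (hb : ContDiff ℝ 1 b) (p : ℝ × ℝ) :
    HasFDerivAt (fun p : ℝ × ℝ => a p.1 * b p.2)
      (a p.1 • deriv b p.2 • ContinuousLinearMap.snd ℝ ℝ ℝ +
        b p.2 • deriv a p.1 • ContinuousLinearMap.fst ℝ ℝ ℝ) p := by
  have h1 := ((ha.differentiable one_ne_zero) p.1).hasDerivAt.comp_hasFDerivAt p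
    (hasFDerivAt_fst (𝕜 := ℝ) (p := p))
  have h2 := ((hb.differentiable one_ne_zero) p.2).hasDerivAt.comp_hasFDerivAt p
    (hasFDerivAt_snd (𝕜 := ℝ) (p := p))
  exact h1.fun_mul h2

lemma abs_mul_prod_le_one (ha1 : ∀ t, |a t| ≤ 1) (hb1 : ∀ t, |b t| ≤ 1) (p : ℝ × ℝ) :
    (a p.1 * b p.2) ^ 2 ≤ 1 := by
  rw [sq_le_one_iff_abs_le_one, abs_mul]
  exact mul_le_one₀ (ha1 _) (abs_nonneg _) (hb1 _)

lemma integral_deriv_mul_le_perimeter {E : Set (ℝ × ℝ)} (hper : perimeter E < ⊤)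
    (ha : ContDiff ℝ 1 a) (hac : HasCompactSupport a) (ha1 : ∀ t, |a t| ≤ 1)
    (hb : ContDiff ℝ 1 b) (hbc : HasCompactSupport b) (hb1 : ∀ t, |b t| ≤ 1) :
    ∫ p in E, deriv a p.1 * b p.2 ≤ (perimeter E).toReal ∧
      ∫ p in E, a p.1 * deriv b p.2 ≤ (perimeter E).toReal := by
  have hF : ContDiff ℝ 1 fun p : ℝ × ℝ => a p.1 * b p.2 :=
    (ha.comp contDiff_fst).mul (hb.comp contDiff_snd)
  have hFc := hasCompactSupport_mul_prod hac hbc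
  have hd := hasFDerivAt_mul_prod ha hb
  constructor
  · have hdiv : planeDiv (fun p => (a p.1 * b p.2, 0)) = fun p => deriv a p.1 * b p.2 := by
      funext p
      have h1 := (hd p).prodMk (hasFDerivAt_const (0 : ℝ) p)
      rw [planeDiv, h1.fderiv]
      simp [mul_comm]
    rw [← hdiv]
    refine integral_planeDiv_le_perimeter hper (hF.prodMk contDiff_const) ?_ fun p => ?_
    · exact hFc.comp_left (g := fun t : ℝ => (t, (0 : ℝ))) rfl
    · rw [Real.sqrt_le_one]
      simpa using abs_mul_prod_le_one ha1 hb1 p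
  · have hdiv : planeDiv (fun p => (0, a p.1 * b p.2)) = fun p => a p.1 * deriv b p.2 := by
      funext p
      have h1 := (hasFDerivAt_const (0 : ℝ) p).prodMk (hd p)
      rw [planeDiv, h1.fderiv]
      simp
    rw [← hdiv]
    refine integral_planeDiv_le_perimeter hper (contDiff_const.prodMk hF) ?_ fun p => ?_
    · exact hFc.comp_left (g := fun t : ℝ => ((0 : ℝ), t)) rfl
    · rw [Real.sqrt_le_one]
      simpa using abs_mul_prod_le_one ha1 hb1 p

end ProductFields

lemma exists_cutoff (n : ℕ) : ∃ χ : ℝ → ℝ, ContDiff ℝ 1 χ ∧ HasCompactSupport χ ∧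
    (∀ t, |χ t| ≤ 1) ∧ (∀ t : ℝ, |t| ≤ n → χ t = 1) ∧ (∀ t, χ (-t) = χ t) ∧ ∀ t, 0 ≤ χ t := by
  let φ : ContDiffBump (0 : ℝ) := ⟨n + 1, n + 2, by positivity, by linarith⟩
  refine ⟨φ, φ.contDiff, φ.hasCompactSupport, fun t => ?_, fun t ht => ?_, φ.neg, fun t => φ.nonneg⟩
  · rw [abs_of_nonneg φ.nonneg]
    exact φ.le_one
  · refine φ.one_of_mem_closedBall ?_
    rw [Metric.mem_closedBall, Real.dist_eq, sub_zero]
    exact ht.trans (by simp [φ])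

lemma exists_norm_deriv_le {a : ℝ → ℝ} (ha : ContDiff ℝ 1 a) (hac : HasCompactSupport a) :
    ∃ C, ∀ t, ‖deriv a t‖ ≤ C :=
  (ha.continuous_deriv le_rfl).bounded_above_of_compact_support hac.deriv

open Filter Topology in
/-- On a set of finite area the fields `(a(x), 0)` and `(0, a(y))`, which are not compactly supported,
may be used to test the perimeter as well. -/
lemma integral_deriv_le_perimeter {E : Set (ℝ × ℝ)} (harea : volume E < ⊤)
    (hper : perimeter E < ⊤) {a : ℝ → ℝ} (ha : ContDiff ℝ 1 a) (hac : HasCompactSupport a)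
    (ha1 : ∀ t, |a t| ≤ 1) :
    ∫ p in E, deriv a p.1 ≤ (perimeter E).toReal ∧
      ∫ p in E, deriv a p.2 ≤ (perimeter E).toReal := by
  have : IsFiniteMeasure (volume.restrict E) := ⟨by simpa using harea⟩
  choose χ hχ hχc hχ1 hχn _ _ using exists_cutoff
  obtain ⟨C, hC⟩ := exists_norm_deriv_le ha hac
  have hda := ha.continuous_deriv le_rfl
  have key : ∀ (i j : ℝ × ℝ → ℝ), Continuous i → Continuous j →
      (∀ n, ∫ p in E, deriv a (i p) * χ n (j p) ≤ (perimeter E).toReal) →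
      ∫ p in E, deriv a (i p) ≤ (perimeter E).toReal := by
    intro i j hi hj hle
    refine le_of_tendsto (tendsto_integral_of_dominated_convergence (fun _ => C) (fun n => ?_)
      (integrable_const C) (fun n => ?_) ?_) (Eventually.of_forall hle)
    · exact ((hda.comp hi).mul ((hχ n).continuous.comp hj)).aestronglyMeasurable
    · refine Eventually.of_forall fun p => ?_
      rw [norm_mul]
      exact (mul_le_of_le_one_right (norm_nonneg _) (hχ1 n _)).trans (hC _)
    · refine Eventually.of_forall fun p => tendsto_const_nhds.congr' ?_
      obtain ⟨N, hN⟩ := exists_nat_ge |j p|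
      filter_upwards [eventually_ge_atTop N] with n hn
      rw [hχn n _ (hN.trans (by exact_mod_cast hn)), mul_one]
  exact ⟨key Prod.fst Prod.snd continuous_fst continuous_snd fun n =>
      (integral_deriv_mul_le_perimeter hper ha hac ha1 (hχ n) (hχc n) (hχ1 n)).1,
    key Prod.snd Prod.fst continuous_snd continuous_fst fun n => by
      simpa only [mul_comm] using
        (integral_deriv_mul_le_perimeter hper (hχ n) (hχc n) (hχ1 n) ha hac ha1).2⟩

section Fubini

variable {E : Set (ℝ × ℝ)}

lemma indicator_eq_indicator_vertSection (G : ℝ × ℝ → ℝ) (x y : ℝ) :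
    E.indicator G (x, y) = (vertSection E x).indicator (fun y => G (x, y)) y := rfl

lemma integral_eq_integral_vertSection (hmeas : NullMeasurableSet E volume)
    (hconv : IsYConvex E) {G : ℝ × ℝ → ℝ} (hG : IntegrableOn G E) :
    ∫ p in E, G p = ∫ x, ∫ y in vertSection E x, G (x, y) := by
  rw [← integral_indicator₀ hmeas, Measure.volume_eq_prod,
    integral_prod _ (hG.integrable_indicator₀ hmeas)]
  refine integral_congr_ae (Filter.Eventually.of_forall fun x => ?_)
  simp only [indicator_eq_indicator_vertSection]
  rw [integral_indicator (hconv x).1.measurableSet]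

lemma integrable_integral_vertSection (hmeas : NullMeasurableSet E volume)
    (hconv : IsYConvex E) {G : ℝ × ℝ → ℝ} (hG : IntegrableOn G E) :
    Integrable fun x => ∫ y in vertSection E x, G (x, y) := by
  have h1 : Integrable (E.indicator G) (volume.prod volume) := hG.integrable_indicator₀ hmeas
  refine h1.integral_prod_left.congr (Filter.Eventually.of_forall fun x => ?_)
  simp only [indicator_eq_indicator_vertSection]
  rw [integral_indicator (hconv x).1.measurableSet]

lemma ae_volume_vertSection_lt_top (hmeas : NullMeasurableSet E volume) (harea : volume E < ⊤)
    (hconv : IsYConvex E) : ∀ᵐ x, volume (vertSection E x) < ⊤ := by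
  have h1 : Integrable (E.indicator fun _ => (1 : ℝ)) (volume.prod volume) :=
    (integrableOn_const (C := (1 : ℝ)) harea.ne).integrable_indicator₀ hmeas
  filter_upwards [h1.prod_right_ae] with x hx
  simp only [indicator_eq_indicator_vertSection] at hx
  rw [integrable_indicator_iff (hconv x).1.measurableSet, integrableOn_const_iff] at hx
  simpa using hx

end Fubini

/-! ### The profile of a Schwarz symmetric set of finite perimeter -/

/-- `u` is the half-height of almost every vertical section of `E`, represented by a function that is
continuous off a countable set; it is essentially bounded and vanishes off a set of finite length. -/
structure IsProfile (E : Set (ℝ × ℝ)) (u : ℝ → ℝ) (K : ℝ) : Prop where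
  nonneg : ∀ x, 0 ≤ u x
  measurable : Measurable u
  countable : {x | ¬ ContinuousAt u x}.Countable
  mem_iff : ∀ᵐ x, ∀ y, (x, y) ∈ E ↔ |y| < u x
  le : ∀ᵐ x, u x ≤ K
  eq_zero : ∀ᵐ x, x < 0 → u x = 0
  volume_lt : volume {x | 0 < u x} < ⊤

lemma exists_bdd_profile {E : Set (ℝ × ℝ)} (hEH : E ⊆ closedHalfPlane)
    (hmeas : NullMeasurableSet E volume) (harea : volume E < ⊤) (hper : perimeter E < ⊤)
    (hschwarz : IsYSchwarzSymmetric E) :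
    ∃ (u : ℝ → ℝ) (K : ℝ), (∀ x, 0 ≤ u x) ∧ Measurable u ∧ {x | ¬ ContinuousAt u x}.Countable ∧
      (∀ᵐ x, ∀ y, (x, y) ∈ E ↔ |y| < u x) ∧ ∀ᵐ x, u x ≤ K := by
  obtain ⟨hsymm, hconv⟩ := hschwarz
  set V : ℝ → ℝ := fun x => (volume (vertSection E x)).toReal with hV
  set P := (perimeter E).toReal with hP
  have hone : IntegrableOn (fun _ : ℝ × ℝ => (1 : ℝ)) E := integrableOn_const harea.ne
  have hVi : Integrable V := by
    refine (integrable_integral_vertSection hmeas hconv hone).congr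
      (Filter.Eventually.of_forall fun x => ?_)
    simp [hV, Measure.real]
  obtain ⟨S, hS, hSvar⟩ := exists_eVariationOn_le hVi (C := P) fun a ha hac ha1 => by
    have h1 := (integral_deriv_le_perimeter harea hper ha hac ha1).1
    obtain ⟨C, hC⟩ := exists_norm_deriv_le ha hac
    have hint : IntegrableOn (fun p : ℝ × ℝ => deriv a p.1) E :=
      Measure.integrableOn_of_bounded harea.ne
        ((ha.continuous_deriv le_rfl).comp continuous_fst).aestronglyMeasurable
        (Filter.Eventually.of_forall fun p => hC p.1)
    rw [integral_eq_integral_vertSection hmeas hconv hint] at h1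
    simpa [hV, Measure.real, mul_comm] using h1
  have hbv : BoundedVariationOn V S := ne_top_of_le_ne_top ENNReal.ofReal_ne_top hSvar
  obtain ⟨p, q, hp, hq, hpq⟩ := exists_monotone_sub_of_eVariationOn_ne_top hS hbv
  -- The sections over negative abscissas are empty.
  have hV0 : ∀ x < 0, V x = 0 := by
    intro x hx
    have : vertSection E x = ∅ := by
      ext y
      simp only [vertSection, mem_ofPred_eq, mem_empty_iff_false, iff_false]
      exact fun h => absurd (hEH h) (not_le.2 hx)
    simp [hV, this]
  obtain ⟨x₀, hx₀, hx₀S⟩ : ∃ x < 0, x ∈ S := by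
    have : (Iio (0 : ℝ) ∩ S).Nonempty := by
      refine nonempty_of_measure_ne_zero (μ := volume) ?_
      rw [measure_inter_conull (by rw [← mem_ae_iff]; exact hS)]
      simp
    exact this
  refine ⟨fun x => max 0 ((p x - q x) / 2), P / 2, fun x => le_max_left _ _,
    measurable_const.max ((hp.measurable.sub hq.measurable).div_const 2), ?_, ?_, ?_⟩
  · refine (hp.countable_not_continuousAt.union hq.countable_not_continuousAt).mono fun x hx => ?_
    by_contra hcon
    simp only [mem_union, mem_ofPred_eq, not_or, not_not] at hcon
    exact hx (continuousAt_const.max ((hcon.1.sub hcon.2).div_const 2))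
  · filter_upwards [hpq, ae_volume_vertSection_lt_top hmeas harea hconv] with x hx hfin y
    have hVx : 0 ≤ V x := ENNReal.toReal_nonneg
    rw [← hx, max_eq_right (by positivity)]
    change y ∈ vertSection E x ↔ _
    rw [mem_iff_lt_volume_of_symmetric (hconv x) (hsymm x),
      ← ENNReal.ofReal_toReal hfin.ne, ENNReal.ofReal_lt_ofReal_iff_of_nonneg (by positivity),
      lt_div_iff₀ two_pos, mul_comm]
  · filter_upwards [hpq, hS] with x hx hxS
    have hVx : 0 ≤ V x := ENNReal.toReal_nonneg
    rw [← hx, max_eq_right (by positivity)]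
    have h1 := hbv.sub_le hxS hx₀S
    rw [hV0 x₀ hx₀, sub_zero] at h1
    have h2 := ENNReal.toReal_mono ENNReal.ofReal_ne_top hSvar
    rw [ENNReal.toReal_ofReal ENNReal.toReal_nonneg] at h2
    linarith

/-- A smooth odd function that is equal to `1` on `[1 / (n + 1), K]`, used as a vertical test field. -/
lemma exists_odd_cutoff (n : ℕ) (K : ℝ) : ∃ b : ℝ → ℝ, ContDiff ℝ 1 b ∧ HasCompactSupport b ∧
    (∀ t, |b t| ≤ 1) ∧ (∀ t, b (-t) = -b t) ∧ (∀ t, 0 ≤ t → 0 ≤ b t) ∧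
    ∀ t, 1 / ((n : ℝ) + 1) ≤ t → t ≤ K → b t = 1 := by
  obtain ⟨N, hN⟩ := exists_nat_ge K
  obtain ⟨χ, hχ, hχc, hχ1, hχN, hχe, hχ0⟩ := exists_cutoff N
  have hn : 0 < (n : ℝ) + 1 := by positivity
  set θ : ℝ → ℝ := fun t => Real.smoothTransition (((n : ℝ) + 1) * t) -
    Real.smoothTransition (-(((n : ℝ) + 1) * t)) with hθ
  have hθC : ContDiff ℝ 1 θ :=
    (Real.smoothTransition.contDiff.comp (contDiff_const.mul contDiff_id)).sub
      (Real.smoothTransition.contDiff.comp (contDiff_const.mul contDiff_id).neg)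
  have hθ0 : ∀ t, 0 ≤ t → θ t = Real.smoothTransition (((n : ℝ) + 1) * t) := by
    intro t ht
    simp only [hθ]
    rw [Real.smoothTransition.zero_of_nonpos (x := -(((n : ℝ) + 1) * t))
      (by simpa using by positivity), sub_zero]
  refine ⟨fun t => θ t * χ t, hθC.mul hχ, hχc.mul_left, fun t => ?_, fun t => ?_, fun t ht => ?_,
    fun t ht htK => ?_⟩
  · rw [abs_mul]
    refine mul_le_one₀ (abs_sub_le_iff.2 ⟨?_, ?_⟩) (abs_nonneg _) (hχ1 t)
    · linarith [Real.smoothTransition.le_one (((n : ℝ) + 1) * t),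
        Real.smoothTransition.nonneg (-(((n : ℝ) + 1) * t))]
    · linarith [Real.smoothTransition.le_one (-(((n : ℝ) + 1) * t)),
        Real.smoothTransition.nonneg (((n : ℝ) + 1) * t)]
  · simp only [hθ, hχe]
    rw [mul_neg, neg_neg]
    ring
  · simp only
    rw [hθ0 t ht]
    exact mul_nonneg (Real.smoothTransition.nonneg _) (hχ0 t)
  · have ht0 : 0 < t := (by positivity : 0 < 1 / ((n : ℝ) + 1)).trans_le ht
    simp only
    rw [hθ0 t ht0.le, hχN t (by rw [abs_of_pos ht0]; exact htK.trans hN), mul_one]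
    refine Real.smoothTransition.one_of_one_le ?_
    rw [div_le_iff₀ hn] at ht
    linarith

/-- A Schwarz symmetric set of finite area and finite perimeter has a profile: testing the perimeter
with horizontal fields bounds the variation of the heights of the sections, and testing it with
vertical fields bounds the measure of the projection to the horizontal axis. -/
lemma exists_isProfile {E : Set (ℝ × ℝ)} (hEH : E ⊆ closedHalfPlane)
    (hmeas : NullMeasurableSet E volume) (harea : volume E < ⊤) (hper : perimeter E < ⊤)
    (hschwarz : IsYSchwarzSymmetric E) : ∃ u K, IsProfile E u K := by
  obtain ⟨u, K, hu0, hum, huc, huE, huK⟩ := exists_bdd_profile hEH hmeas harea hper hschwarz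
  have hneg : ∀ᵐ x, x < 0 → u x = 0 := by
    filter_upwards [huE] with x hx hx0
    refine le_antisymm (not_lt.1 fun hu => ?_) (hu0 x)
    exact absurd (hEH ((hx 0).2 (by simpa using hu))) (not_le.2 hx0)
  refine ⟨u, K, hu0, hum, huc, huE, huK, hneg, ?_⟩
  have hn : ∀ n : ℕ, volume {x | 1 / ((n : ℝ) + 1) ≤ u x} ≤
      ENNReal.ofReal ((perimeter E).toReal / 2) := by
    intro n
    obtain ⟨b, hb, hbc, hb1, hbodd, hb0, hbK⟩ := exists_odd_cutoff n K
    obtain ⟨C, hC⟩ := exists_norm_deriv_le hb hbc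
    have hbd := hb.continuous_deriv le_rfl
    have hint : IntegrableOn (fun p : ℝ × ℝ => deriv b p.2) E :=
      Measure.integrableOn_of_bounded harea.ne
        (hbd.comp continuous_snd).aestronglyMeasurable (Filter.Eventually.of_forall fun p => hC p.2)
    have hval : ∀ᵐ x, ∫ y in vertSection E x, deriv b y = 2 * b (u x) := by
      filter_upwards [huE] with x hx
      have hsec : vertSection E x = Ioo (-u x) (u x) := by
        ext y
        rw [mem_Ioo, ← abs_lt, ← hx y]
        rfl
      rw [hsec, ← integral_Ioc_eq_integral_Ioo,
        ← intervalIntegral.integral_of_le (by linarith [hu0 x]),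
        intervalIntegral.integral_deriv_eq_sub
          (fun y _ => (hb.differentiable one_ne_zero) y) (hbd.intervalIntegrable _ _), hbodd]
      ring
    have h1 := (integral_deriv_le_perimeter harea hper hb hbc hb1).2
    rw [integral_eq_integral_vertSection hmeas hschwarz.2 hint, integral_congr_ae hval] at h1
    have h2 : Integrable fun x => 2 * b (u x) :=
      (integrable_integral_vertSection hmeas hschwarz.2 hint).congr hval
    have h3 := mul_meas_ge_le_integral_of_nonneg (Filter.Eventually.of_forall
      fun x => mul_nonneg zero_le_two (hb0 _ (hu0 x))) h2 2
    have h4 : volume {x | 2 ≤ 2 * b (u x)} < ⊤ := h2.measure_ge_lt_top two_pos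
    calc volume {x | 1 / ((n : ℝ) + 1) ≤ u x} ≤ volume {x | 2 ≤ 2 * b (u x)} := by
          refine measure_mono_ae ?_
          filter_upwards [huK] with x hxK hx
          change 2 ≤ 2 * b (u x)
          rw [hbK _ hx hxK, mul_one]
      _ = ENNReal.ofReal (volume.real {x | 2 ≤ 2 * b (u x)}) := (ENNReal.ofReal_toReal h4.ne).symm
      _ ≤ _ := ENNReal.ofReal_le_ofReal (by linarith)
  have hUnion : {x | 0 < u x} = ⋃ n : ℕ, {x | 1 / ((n : ℝ) + 1) ≤ u x} := by
    ext x
    simp only [mem_ofPred_eq, mem_iUnion]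
    constructor
    · intro hx
      obtain ⟨n, hn⟩ := exists_nat_one_div_lt hx
      exact ⟨n, hn.le⟩
    · rintro ⟨n, hn⟩
      exact (by positivity : 0 < 1 / ((n : ℝ) + 1)).trans_le hn
  have hmono : Monotone fun n : ℕ => {x | 1 / ((n : ℝ) + 1) ≤ u x} := by
    intro m n hmn x hx
    have : (m : ℝ) ≤ n := by exact_mod_cast hmn
    exact (one_div_le_one_div_of_le (a := (m : ℝ) + 1) (by positivity) (by linarith)).trans hx
  rw [hUnion, hmono.measure_iUnion]
  exact (iSup_le hn).trans_lt ENNReal.ofReal_lt_top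

/-! ### The functions `φ_E` and `λ_E` as measures of level sets -/

open Filter Topology in
lemma tendsto_measure_biUnion_gt {α : Type*} [MeasurableSpace α] (μ : Measure α) {s : ℝ → Set α}
    {a : ℝ} (hs : ∀ i j, a < i → i ≤ j → s j ⊆ s i) :
    Tendsto (fun r => μ (s r)) (𝓝[>] a) (𝓝 (μ (⋃ r > a, s r))) := by
  obtain ⟨v, hv, hva, hvlim⟩ := exists_seq_strictAnti_tendsto a
  have hUnion : ⋃ r > a, s r = ⋃ n, s (v n) := by
    refine subset_antisymm (iUnion₂_subset fun r hr => ?_) (iUnion_subset fun n => ?_)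
    · obtain ⟨n, hn⟩ := (hvlim.eventually_lt_const hr).exists
      exact (hs (v n) r (hva n) hn.le).trans (subset_iUnion (fun n => s (v n)) n)
    · exact subset_biUnion_of_mem (u := s) (hva n)
  have hmono : Monotone fun n => s (v n) := fun m n hmn => hs _ _ (hva n) (hv.antitone hmn)
  refine tendsto_order.2 ⟨fun b hb => ?_, fun b hb => ?_⟩
  · rw [hUnion, hmono.measure_iUnion] at hb
    obtain ⟨n, hn⟩ := lt_iSup_iff.1 hb
    filter_upwards [Ioo_mem_nhdsGT (hva n)] with r hr
    exact hn.trans_le (measure_mono (hs r (v n) hr.1 hr.2.le))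
  · filter_upwards [self_mem_nhdsWithin] with r hr
    exact (measure_mono (subset_biUnion_of_mem (u := s) hr)).trans_lt hb

open Filter Topology in
lemma tendsto_nhdsLT_of_tendsto_neg {β : Type*} {F : ℝ → β} {a : ℝ} {L : Filter β}
    (h : Tendsto (fun r => F (-r)) (𝓝[>] (-a)) L) : Tendsto F (𝓝[<] a) L := by
  simpa [Function.comp_def] using h.comp (tendsto_neg_nhdsLT (a := a))

lemma toENNReal_sSup_of_isLowerSet {T : Set ℝ} (h0 : 0 ∈ T) (hT : IsLowerSet T) :
    (sSup {s : EReal | ∃ t : ℝ, s = (t : EReal) ∧ t ∈ T}).toENNReal =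
      volume {x | 0 ≤ x ∧ x ∈ T} := by
  by_cases hb : BddAbove T
  · have hsup : sSup {s : EReal | ∃ t : ℝ, s = (t : EReal) ∧ t ∈ T} = ((sSup T : ℝ) : EReal) := by
      refine le_antisymm (sSup_le ?_) (le_of_forall_lt fun b hbT => ?_)
      · rintro _ ⟨t, rfl, ht⟩
        exact EReal.coe_le_coe_iff.2 (le_csSup hb ht)
      · obtain ⟨r, hbr, hr⟩ := EReal.lt_iff_exists_real_btwn.1 hbT
        obtain ⟨t, ht, hrt⟩ := exists_lt_of_lt_csSup ⟨0, h0⟩ (EReal.coe_lt_coe_iff.1 hr)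
        exact (hbr.trans (EReal.coe_lt_coe_iff.2 hrt)).trans_le (le_sSup ⟨t, rfl, ht⟩)
    rw [hsup, EReal.toENNReal_of_ne_top (EReal.coe_ne_top _), EReal.toReal_coe]
    refine le_antisymm ?_ ?_
    · calc ENNReal.ofReal (sSup T) = volume (Ico 0 (sSup T)) := by rw [Real.volume_Ico, sub_zero]
        _ ≤ _ := by
          refine measure_mono fun x hx => ⟨hx.1, ?_⟩
          obtain ⟨t, ht, hxt⟩ := exists_lt_of_lt_csSup ⟨0, h0⟩ hx.2
          exact hT hxt.le ht
    · calc volume {x | 0 ≤ x ∧ x ∈ T} ≤ volume (Icc 0 (sSup T)) :=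
            measure_mono fun x hx => ⟨hx.1, le_csSup hb hx.2⟩
        _ = ENNReal.ofReal (sSup T) := by rw [Real.volume_Icc, sub_zero]
  · have hTu : ∀ x, x ∈ T := by
      intro x
      obtain ⟨t, ht, hxt⟩ := not_bddAbove_iff.1 hb x
      exact hT hxt.le ht
    have hsup : sSup {s : EReal | ∃ t : ℝ, s = (t : EReal) ∧ t ∈ T} = ⊤ := by
      refine eq_top_iff.2 (le_of_forall_lt fun b hbT => ?_)
      obtain ⟨r, hbr, -⟩ := EReal.lt_iff_exists_real_btwn.1 hbT
      exact hbr.trans_le (le_sSup ⟨r, rfl, hTu r⟩)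
    have hset : {x : ℝ | 0 ≤ x ∧ x ∈ T} = Ici 0 := by
      ext x
      simp [hTu x]
    rw [hsup, hset, Real.volume_Ici, EReal.toENNReal_top]

/-- The essential supremum of the nonnegative function `u` on the half-line `(-∞, x)`. -/
noncomputable def leftEssSup (u : ℝ → ℝ) (x : ℝ) : ℝ :=
  sInf {s | 0 ≤ s ∧ volume ({z | s < u z} ∩ Iio x) = 0}

/-- The set of abscissas `x ≥ 0` to the left of which `u` stays essentially below `t` (below some
smaller level, unless `t = 0`). Its length is `φ_E(t)` if `u` is the profile of `E`. -/
def lowSet (u : ℝ → ℝ) (t : ℝ) : Set ℝ := {x | 0 ≤ x ∧ (leftEssSup u x < t ∨ leftEssSup u x ≤ 0)}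

/-- The superlevel set `{u ≥ t}` without the zeros of `u`. Its length is `λ_E(t)` if `u` is the profile
of `E`. -/
def highSet (u : ℝ → ℝ) (t : ℝ) : Set ℝ := {x | t ≤ u x ∧ 0 < u x}

/-- The points at which the running essential supremum of `u` is equal to `d`. -/
def levelSet (u : ℝ → ℝ) (d : ℝ) : Set ℝ := {x | 0 ≤ x ∧ leftEssSup u x = d}

lemma leftEssSup_nonneg (u : ℝ → ℝ) (x : ℝ) : 0 ≤ leftEssSup u x :=
  Real.sInf_nonneg fun _ hs => hs.1

lemma lowSet_mono (u : ℝ → ℝ) : Monotone (lowSet u) :=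
  fun _ _ hst _ hx => ⟨hx.1, hx.2.imp_left fun h => h.trans_le hst⟩

lemma lowSet_of_pos (u : ℝ → ℝ) {t : ℝ} (ht : 0 < t) :
    lowSet u t = {x | 0 ≤ x ∧ leftEssSup u x < t} := by
  ext x
  exact and_congr_right fun _ => ⟨fun h => h.elim id fun h => h.trans_lt ht, Or.inl⟩

lemma lowSet_zero (u : ℝ → ℝ) : lowSet u 0 = {x | 0 ≤ x ∧ leftEssSup u x ≤ 0} := by
  ext x
  exact and_congr_right fun _ => ⟨fun h => h.elim le_of_lt id, Or.inr⟩

namespace IsProfile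

variable {E : Set (ℝ × ℝ)} {u : ℝ → ℝ} {K : ℝ}

lemma leftEssSup_le_iff (h : IsProfile E u K) {s : ℝ} (hs : 0 ≤ s) (x : ℝ) :
    leftEssSup u x ≤ s ↔ volume ({z | s < u z} ∩ Iio x) = 0 := by
  constructor
  · intro hle
    have hne : {s | 0 ≤ s ∧ volume ({z | s < u z} ∩ Iio x) = 0}.Nonempty := by
      refine ⟨max K 0, le_max_right _ _, measure_mono_null inter_subset_left ?_⟩
      rw [measure_eq_zero_iff_ae_notMem]
      filter_upwards [h.le] with z hz hz'
      exact absurd (lt_of_le_of_lt (le_max_left K 0) hz') (not_lt.2 hz)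
    have hsub : {z | s < u z} ∩ Iio x ⊆
        ⋃ n : ℕ, {z | leftEssSup u x + 1 / ((n : ℝ) + 1) < u z} ∩ Iio x := by
      rintro z ⟨hz, hzx⟩
      obtain ⟨n, hn⟩ := exists_nat_one_div_lt (sub_pos.2 (hle.trans_lt hz))
      exact mem_iUnion.2 ⟨n, show _ < u z by linarith, hzx⟩
    refine measure_mono_null hsub (measure_iUnion_null fun n => ?_)
    obtain ⟨s', ⟨-, hs'⟩, hlt⟩ := exists_lt_of_csInf_lt hne
      (show leftEssSup u x < leftEssSup u x + 1 / ((n : ℝ) + 1) by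
        have : 0 < 1 / ((n : ℝ) + 1) := by positivity
        linarith)
    exact measure_mono_null (inter_subset_inter_left _ fun z hz => hlt.trans hz) hs'
  · exact fun h0 => csInf_le ⟨0, fun _ hs => hs.1⟩ ⟨hs, h0⟩

lemma monotone_leftEssSup (h : IsProfile E u K) : Monotone (leftEssSup u) := fun x y hxy =>
  (h.leftEssSup_le_iff (leftEssSup_nonneg u y) x).2 <| measure_mono_null
    (inter_subset_inter_right _ (Iio_subset_Iio hxy))
    ((h.leftEssSup_le_iff (leftEssSup_nonneg u y) y).1 le_rfl)

lemma measurable_leftEssSup (h : IsProfile E u K) : Measurable (leftEssSup u) :=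
  h.monotone_leftEssSup.measurable

lemma leftEssSup_zero (h : IsProfile E u K) : leftEssSup u 0 = 0 := by
  refine le_antisymm ((h.leftEssSup_le_iff le_rfl 0).2 ?_) (leftEssSup_nonneg u 0)
  rw [measure_eq_zero_iff_ae_notMem]
  filter_upwards [h.eq_zero] with z hz hz'
  exact hz'.1.ne' (hz hz'.2)

lemma measurableSet_lowSet (h : IsProfile E u K) (t : ℝ) : MeasurableSet (lowSet u t) :=
  measurableSet_Ici.inter ((h.measurable_leftEssSup measurableSet_Iio).union
    (h.measurable_leftEssSup measurableSet_Iic))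

lemma measurableSet_levelSet (h : IsProfile E u K) (d : ℝ) : MeasurableSet (levelSet u d) :=
  measurableSet_Ici.inter (h.measurable_leftEssSup (measurableSet_singleton d))

lemma measurableSet_highSet (h : IsProfile E u K) (t : ℝ) : MeasurableSet (highSet u t) :=
  (h.measurable measurableSet_Ici).inter (h.measurable measurableSet_Ioi)

lemma volume_highSet_lt_top (h : IsProfile E u K) (t : ℝ) : volume (highSet u t) < ⊤ :=
  (measure_mono fun _ hx => hx.2).trans_lt h.volume_lt

lemma horizSection_ae_eq (h : IsProfile E u K) (t : ℝ) :
    horizSection E t =ᵐ[volume] {x | |t| < u x} := by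
  filter_upwards [h.mem_iff] with x hx
  exact propext (hx t)

lemma sectionLength_eq (h : IsProfile E u K) (t : ℝ) :
    sectionLength E t = volume {x | |t| < u x} := measure_congr (h.horizSection_ae_eq t)

lemma sectionEssInf_eq (h : IsProfile E u K) (t : ℝ) :
    sectionEssInf E t = volume {x | 0 ≤ x ∧ leftEssSup u x ≤ |t|} := by
  have hnull : ∀ r : ℝ, volume (horizSection E t ∩ Iio r) = 0 ↔ leftEssSup u r ≤ |t| := by
    intro r
    rw [h.leftEssSup_le_iff (abs_nonneg t),
      measure_congr ((h.horizSection_ae_eq t).inter (ae_eq_refl (Iio r)))]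
  rw [sectionEssInf, essInfSet]
  simp_rw [hnull]
  refine toENNReal_sSup_of_isLowerSet (T := {r | leftEssSup u r ≤ |t|}) ?_ fun a b hba ha =>
    (h.monotone_leftEssSup hba).trans ha
  rw [mem_ofPred_eq, h.leftEssSup_zero]
  exact abs_nonneg t

open Filter Topology in
/-- The limit from the right of the lengths of the sets `{x ≥ 0 : g x ≤ t}` and of their variant
`lowSet u t`, for the running essential supremum `g` of `u`. -/
lemma tendsto_volume_of_between (h : IsProfile E u K) {d : ℝ} {s : ℝ → Set ℝ}
    (hmeas : ∀ r, MeasurableSet (s r)) (hmono : ∀ i j, d < i → i ≤ j → s i ⊆ s j)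
    (hlow : ∀ r > d, {x | 0 ≤ x ∧ leftEssSup u x ≤ d} ⊆ s r)
    (hup : ∀ r > d, s r ⊆ {x | 0 ≤ x ∧ leftEssSup u x ≤ r}) :
    Tendsto (fun r => volume (s r)) (𝓝[>] d) (𝓝 (volume {x | 0 ≤ x ∧ leftEssSup u x ≤ d})) := by
  by_cases hex : ∃ x, d < leftEssSup u x
  · obtain ⟨x, hx⟩ := hex
    obtain ⟨r, hdr, hrx⟩ := exists_between hx
    have hfin : volume (s r) ≠ ⊤ := by
      refine ne_top_of_le_ne_top (b := volume (Icc 0 x)) (by simp) (measure_mono fun z hz => ?_)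
      have hz' := hup r hdr hz
      exact ⟨hz'.1, (h.monotone_leftEssSup.reflect_lt (hz'.2.trans_lt hrx)).le⟩
    have hInter : ⋂ r > d, s r = {x | 0 ≤ x ∧ leftEssSup u x ≤ d} := by
      refine subset_antisymm (fun z hz => ?_) (subset_iInter₂ hlow)
      rw [mem_iInter₂] at hz
      exact ⟨(hup r hdr (hz r hdr)).1, le_of_forall_gt_imp_ge_of_dense fun r' hr' =>
        (hup r' hr' (hz r' hr')).2⟩
    rw [← hInter]
    exact tendsto_measure_biInter_gt (fun r _ => (hmeas r).nullMeasurableSet) hmono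
      ⟨r, hdr, hfin⟩
  · push Not at hex
    have htop : volume {x | 0 ≤ x ∧ leftEssSup u x ≤ d} = ⊤ := by
      have : {x | 0 ≤ x ∧ leftEssSup u x ≤ d} = Ici 0 := by
        ext x
        simp [hex x]
      rw [this, Real.volume_Ici]
    rw [htop]
    refine tendsto_const_nhds.congr' ?_
    filter_upwards [self_mem_nhdsWithin] with r hr
    exact (eq_top_iff.2 (htop ▸ measure_mono (hlow r hr))).symm

lemma phiFun_eq (h : IsProfile E u K) (t : ℝ) : phiFun E t = volume (lowSet u |t|) := by
  rw [phiFun]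
  refine leftLim_eq_of_tendsto ?_
  rcases (abs_nonneg t).eq_or_lt with ht | ht
  · rw [← ht, lowSet_zero]
    refine tendsto_nhdsLT_of_tendsto_neg ?_
    rw [neg_zero]
    refine (h.tendsto_volume_of_between (s := fun r => {x | 0 ≤ x ∧ leftEssSup u x ≤ r})
      (fun r => measurableSet_Ici.inter (h.measurable_leftEssSup measurableSet_Iic))
      (fun i j _ hij x hx => ⟨hx.1, hx.2.trans hij⟩)
      (fun r hr x hx => ⟨hx.1, hx.2.trans hr.le⟩) (fun r _ => subset_rfl)).congr' ?_
    filter_upwards [self_mem_nhdsWithin] with r hr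
    rw [h.sectionEssInf_eq, abs_neg, abs_of_pos hr]
  · refine tendsto_nhdsLT_of_tendsto_neg ?_
    have hU : ⋃ r > -|t|, {x | 0 ≤ x ∧ leftEssSup u x ≤ -r} = lowSet u |t| := by
      rw [lowSet_of_pos u ht]
      ext x
      simp only [mem_iUnion, mem_ofPred_eq, exists_prop]
      constructor
      · rintro ⟨r, hr, hx0, hx⟩
        exact ⟨hx0, by linarith⟩
      · rintro ⟨hx0, hx⟩
        exact ⟨-leftEssSup u x, by linarith, hx0, by simp⟩
    rw [← hU]
    refine (tendsto_measure_biUnion_gt volume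
      (s := fun r => {x | 0 ≤ x ∧ leftEssSup u x ≤ -r}) fun i j _ hij x hx =>
      ⟨hx.1, hx.2.trans (neg_le_neg hij)⟩).congr' ?_
    filter_upwards [Ioo_mem_nhdsGT (show -|t| < 0 by linarith)] with r hr
    rw [h.sectionEssInf_eq, abs_neg, abs_of_neg hr.2]

lemma lambdaFun_eq (h : IsProfile E u K) (t : ℝ) : lambdaFun E t = volume (highSet u |t|) := by
  rw [lambdaFun]
  refine leftLim_eq_of_tendsto ?_
  refine tendsto_nhdsLT_of_tendsto_neg ?_
  rcases (abs_nonneg t).eq_or_lt with ht | ht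
  · rw [← ht, neg_zero]
    have hU : ⋃ r > (0 : ℝ), {x | r < u x} = highSet u 0 := by
      ext x
      simp only [mem_iUnion, mem_ofPred_eq, exists_prop, highSet]
      constructor
      · rintro ⟨r, hr, hx⟩
        exact ⟨(hr.trans hx).le, hr.trans hx⟩
      · rintro ⟨-, hx⟩
        exact ⟨u x / 2, by linarith, by linarith⟩
    rw [← hU]
    refine (tendsto_measure_biUnion_gt volume (s := fun r => {x | r < u x})
      fun i j _ hij x hx => hij.trans_lt hx).congr' ?_
    filter_upwards [self_mem_nhdsWithin] with r hr
    rw [h.sectionLength_eq, abs_neg, abs_of_pos hr]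
  · have hI : ⋂ r > -|t|, {x | -r < u x ∧ 0 < u x} = highSet u |t| := by
      ext x
      simp only [mem_iInter, mem_ofPred_eq, highSet]
      constructor
      · intro hx
        exact ⟨le_of_forall_lt_imp_le_of_dense fun r hr => by
          simpa using (hx (-r) (by linarith)).1.le, (hx 0 (by linarith)).2⟩
      · rintro ⟨hx, hx0⟩ r hr
        exact ⟨by linarith, hx0⟩
    rw [← hI]
    refine (tendsto_measure_biInter_gt (μ := volume) (s := fun r => {x | -r < u x ∧ 0 < u x})
      (fun r _ => ((h.measurable measurableSet_Ioi).inter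
        (h.measurable measurableSet_Ioi)).nullMeasurableSet)
      (fun i j _ hij x hx => ⟨(neg_le_neg hij).trans_lt hx.1, hx.2⟩)
      ⟨0, by linarith, ((measure_mono fun x hx => hx.2).trans_lt h.volume_lt).ne⟩).congr' ?_
    filter_upwards [Ioo_mem_nhdsGT (show -|t| < 0 by linarith)] with r hr
    rw [h.sectionLength_eq, abs_neg, abs_of_neg hr.2, Function.comp_apply]
    congr 1
    ext x
    exact ⟨fun hx => hx.1, fun hx => ⟨hx, (neg_pos.2 hr.2).trans hx⟩⟩

open Filter Topology in
lemma tendsto_volume_lowSet (h : IsProfile E u K) {d : ℝ} (hd : 0 ≤ d) :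
    Tendsto (fun r => volume (lowSet u r)) (𝓝[>] d)
      (𝓝 (volume {x | 0 ≤ x ∧ leftEssSup u x ≤ d})) := by
  refine h.tendsto_volume_of_between h.measurableSet_lowSet (fun i j _ hij => lowSet_mono u hij)
    (fun r hr x hx => ⟨hx.1, Or.inl (hx.2.trans_lt hr)⟩) fun r hr => ?_
  rw [lowSet_of_pos u (hd.trans_lt hr)]
  exact fun x hx => ⟨hx.1, hx.2.le⟩

open Filter Topology in
lemma tendsto_volume_highSet (u : ℝ → ℝ) {d : ℝ} (hd : 0 ≤ d) :
    Tendsto (fun r => volume (highSet u r)) (𝓝[>] d) (𝓝 (volume {x | d < u x})) := by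
  have hU : ⋃ r > d, highSet u r = {x | d < u x} := by
    ext x
    simp only [mem_iUnion, mem_ofPred_eq, exists_prop, highSet]
    constructor
    · rintro ⟨r, hr, hx, -⟩
      exact hr.trans_le hx
    · intro hx
      exact ⟨u x, hx, le_rfl, hd.trans_lt hx⟩
  rw [← hU]
  exact tendsto_measure_biUnion_gt volume fun i j _ hij x hx => ⟨hij.trans hx.1, hx.2⟩

open Filter Topology in
lemma tendsto_phiFun (h : IsProfile E u K) {d : ℝ} (hd : 0 ≤ d) :
    Tendsto (phiFun E) (𝓝[>] d) (𝓝 (volume {x | 0 ≤ x ∧ leftEssSup u x ≤ d})) := by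
  refine (h.tendsto_volume_lowSet hd).congr' ?_
  filter_upwards [self_mem_nhdsWithin] with r hr
  rw [h.phiFun_eq, abs_of_pos (hd.trans_lt hr)]

lemma volume_le_eq_add (h : IsProfile E u K) {d : ℝ} (hd : 0 < d) :
    volume {x | 0 ≤ x ∧ leftEssSup u x ≤ d} = volume (lowSet u d) + volume (levelSet u d) := by
  have hU : {x | 0 ≤ x ∧ leftEssSup u x ≤ d} = lowSet u d ∪ levelSet u d := by
    rw [lowSet_of_pos u hd]
    ext x
    simp only [mem_ofPred_eq, mem_union, levelSet, le_iff_lt_or_eq (a := leftEssSup u x), and_or_left]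
  rw [hU, measure_union ?_ (h.measurableSet_levelSet d)]
  rw [lowSet_of_pos u hd, disjoint_left]
  exact fun x hx hx' => hx.2.ne hx'.2

/-- The size of the jump of the translation at `d` compares the length of the set on which the running
essential supremum of `u` is equal to `d` with the length of `{u = d}`. -/
lemma jumpSize_eq (h : IsProfile E u K) {d : ℝ} (hd : 0 < d) (hfin : volume (lowSet u d) ≠ ⊤) :
    jumpSize E d = volume (levelSet u d) - volume {x | u x = d} := by
  have h1 : Function.rightLim (phiFun E) d = volume (lowSet u d) + volume (levelSet u d) := by
    rw [← h.volume_le_eq_add hd]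
    exact rightLim_eq_of_tendsto (h.tendsto_phiFun hd.le)
  have h2 : Function.rightLim (lambdaFun E) d = volume {x | d < u x} := by
    refine rightLim_eq_of_tendsto ((tendsto_volume_highSet u hd.le).congr' ?_)
    filter_upwards [self_mem_nhdsWithin] with r hr
    rw [h.lambdaFun_eq, abs_of_pos (hd.trans hr)]
  have h3 : volume (highSet u d) = volume {x | d < u x} + volume {x | u x = d} := by
    have hU : highSet u d = {x | d < u x} ∪ {x | u x = d} := by
      ext x
      simp only [highSet, mem_ofPred_eq, mem_union]
      constructor
      · rintro ⟨hx, -⟩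
        exact hx.lt_or_eq.imp_right Eq.symm
      · rintro (hx | hx)
        · exact ⟨hx.le, hd.trans hx⟩
        · exact ⟨hx.ge, hx ▸ hd⟩
    have hm : MeasurableSet {x | u x = d} := h.measurable (measurableSet_singleton d)
    rw [hU, measure_union ?_ hm]
    rw [disjoint_left]
    exact fun x hx hx' => (show d < u x from hx).ne' hx'
  have h4 : volume {x | d < u x} ≠ ⊤ :=
    ((measure_mono fun x hx => hd.trans hx).trans_lt h.volume_lt).ne
  rw [jumpSize, h1, h2, h.phiFun_eq, h.lambdaFun_eq, abs_of_pos hd, h3,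
    ENNReal.add_sub_cancel_left hfin, ENNReal.add_sub_cancel_left h4]

lemma mem_jumpSet (h : IsProfile E u K) {d : ℝ} (hd : 0 < d) (hfin : volume (lowSet u d) ≠ ⊤)
    (hpos : 0 < volume (levelSet u d)) : d ∈ jumpSet E := by
  refine ⟨hd, by rwa [h.phiFun_eq, abs_of_pos hd], fun hcont => ?_⟩
  have h1 := tendsto_nhds_unique (hcont.tendsto.mono_left nhdsWithin_le_nhds)
    (h.tendsto_phiFun hd.le)
  rw [h.volume_le_eq_add hd, h.phiFun_eq, abs_of_pos hd] at h1
  have h2 := ENNReal.add_right_inj (c := 0) hfin |>.1 ((h1.symm.trans (add_zero _).symm))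
  exact hpos.ne' h2

end IsProfile

/-! ### Monotonicity of the boundary functions of the rearrangement -/

namespace IsProfile

variable {E : Set (ℝ × ℝ)} {u : ℝ → ℝ} {K : ℝ}

open Filter Topology in
/-- Where the running essential supremum `g` of the profile `u` increases without having a flat piece,
`u` itself attains `g`. This is where the perimeter enters: without continuity of `u` off a null set
the running supremum could be due to thin peaks close to `x`. -/
lemma ae_eq_leftEssSup (h : IsProfile E u K) :
    ∀ᵐ x, 0 ≤ x → volume (levelSet u (leftEssSup u x)) = 0 → u x = leftEssSup u x := by
  filter_upwards [h.countable.ae_notMem volume] with x hcont hx0 hlevel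
  simp only [not_not] at hcont
  have hg := leftEssSup_nonneg u x
  have hnull := (h.leftEssSup_le_iff hg x).1 le_rfl
  refine le_antisymm (not_lt.1 fun hlt => ?_) (not_lt.1 fun hlt => ?_)
  · obtain ⟨ε, hε, hball⟩ := Metric.eventually_nhds_iff.1 (hcont.eventually_const_lt hlt)
    have hsub : Ioo (x - ε) x ⊆ {z | leftEssSup u x < u z} ∩ Iio x := fun z hz =>
      ⟨hball (by rw [Real.dist_eq, abs_lt]; exact ⟨by linarith [hz.1], by linarith [hz.2]⟩), hz.2⟩
    have := measure_mono_null hsub hnull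
    rw [Real.volume_Ioo, ENNReal.ofReal_eq_zero] at this
    linarith
  · obtain ⟨ε, hε, hball⟩ := Metric.eventually_nhds_iff.1 (hcont.eventually_lt_const hlt)
    have hle : leftEssSup u (x + ε / 2) ≤ leftEssSup u x := by
      rw [h.leftEssSup_le_iff hg]
      refine measure_mono_null (show {z | leftEssSup u x < u z} ∩ Iio (x + ε / 2) ⊆
        {z | leftEssSup u x < u z} ∩ Iio x from fun z hz => ⟨hz.1, ?_⟩) hnull
      by_contra hzx
      rw [mem_Iio] at hzx
      have hz2 : z < x + ε / 2 := hz.2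
      have := hball (y := z) (by
        rw [Real.dist_eq, abs_lt]
        exact ⟨by linarith [not_lt.1 hzx], by linarith⟩)
      exact absurd hz.1 (not_lt.2 this.le)
    have hsub : Icc x (x + ε / 2) ⊆ levelSet u (leftEssSup u x) := fun z hz =>
      ⟨hx0.trans hz.1, le_antisymm ((h.monotone_leftEssSup hz.2).trans hle)
        (h.monotone_leftEssSup hz.1)⟩
    have := measure_mono_null hsub hlevel
    rw [Real.volume_Icc, ENNReal.ofReal_eq_zero] at this
    linarith

lemma tauFun_eq_add (E : Set (ℝ × ℝ)) {s t : ℝ} (hs : 0 ≤ s) (hst : s ≤ t) :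
    tauFun E t = tauFun E s + ∑' d : jumpSet E, (Ico s t).indicator (jumpSize E) d := by
  rw [tauFun, tauFun, ← ENNReal.tsum_add, abs_of_nonneg hs, abs_of_nonneg (hs.trans hst)]
  refine tsum_congr fun d => ?_
  simp only [indicator_apply, mem_Ioi, mem_Ico]
  rcases lt_or_ge (d : ℝ) s with h1 | h1
  · simp [h1, h1.trans_le hst, not_le.2 h1]
  · simp [h1, not_lt.2 h1]

lemma tauFun_zero (E : Set (ℝ × ℝ)) : tauFun E 0 = 0 := by
  rw [tauFun, ENNReal.tsum_eq_zero]
  intro d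
  rw [abs_zero]
  exact indicator_of_notMem (fun hd => absurd hd (not_lt.2 d.2.1.le)) _

/-- The increments of `φ_E`, `τ_E` and `-λ_E` over `[s, t)` are ordered in such a way that `φ_E - τ_E` is
nondecreasing and `φ_E - τ_E + λ_E` is nonincreasing. -/
lemma exists_increments (h : IsProfile E u K) {s t : ℝ} (hs : 0 ≤ s) (hst : s ≤ t)
    (hfin : volume (lowSet u t) ≠ ⊤) :
    ∃ G J U : ℝ≥0∞, volume (lowSet u t) = volume (lowSet u s) + G ∧
      tauFun E t = tauFun E s + J ∧ volume (highSet u s) = volume (highSet u t) + U ∧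
      J ≤ G ∧ G ≤ J + U := by
  set g := leftEssSup u with hg
  have hgm : Measurable g := h.measurable_leftEssSup
  set A : Set ℝ := lowSet u t \ lowSet u s with hA
  set B : Set ℝ := highSet u s \ highSet u t with hB
  have hBsub : highSet u t ⊆ highSet u s := fun x hx => ⟨hst.trans hx.1, hx.2⟩
  have hAmem : ∀ x, x ∈ A ↔ 0 ≤ x ∧ g x ∈ Ico s t ∧ 0 < g x := by
    intro x
    simp only [hA, lowSet, Set.mem_sdiff, mem_ofPred_eq, not_and, not_or, not_lt, not_le, mem_Ico]
    constructor
    · rintro ⟨⟨hx0, hx⟩, hx'⟩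
      obtain ⟨h1, h2⟩ := hx' hx0
      exact ⟨hx0, ⟨h1, hx.elim id fun h3 => absurd h3 (not_le.2 h2)⟩, h2⟩
    · rintro ⟨hx0, ⟨h1, h2⟩, h3⟩
      exact ⟨⟨hx0, Or.inl h2⟩, fun _ => ⟨h1, h3⟩⟩
  have hBmem : ∀ x, x ∈ B ↔ u x ∈ Ico s t ∧ 0 < u x := by
    intro x
    simp only [hB, highSet, Set.mem_sdiff, mem_ofPred_eq, not_and, mem_Ico]
    constructor
    · rintro ⟨⟨h1, h2⟩, h3⟩
      exact ⟨⟨h1, not_le.1 fun h4 => h3 h4 h2⟩, h2⟩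
    · rintro ⟨⟨h1, h2⟩, h3⟩
      exact ⟨⟨h1, h3⟩, fun h4 => absurd h4 (not_le.2 h2)⟩
  have hlowfin : ∀ d < t, volume (lowSet u d) ≠ ⊤ := fun d hd =>
    ne_top_of_le_ne_top hfin (measure_mono (lowSet_mono u hd.le))
  refine ⟨volume A, _, volume B, ?_, tauFun_eq_add E hs hst, ?_, ?_, ?_⟩
  · rw [hA, measure_add_sdiff (h.measurableSet_lowSet s).nullMeasurableSet,
      union_eq_right.2 (lowSet_mono u hst)]
  · rw [hB, measure_add_sdiff (h.measurableSet_highSet t).nullMeasurableSet,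
      union_eq_right.2 hBsub]
  · calc ∑' d : jumpSet E, (Ico s t).indicator (jumpSize E) d
        ≤ ∑' d : jumpSet E, volume (levelSet u d ∩ {_x | (d : ℝ) ∈ Ico s t}) := by
          refine ENNReal.tsum_le_tsum fun d => ?_
          by_cases hd : (d : ℝ) ∈ Ico s t
          · rw [indicator_of_mem hd, h.jumpSize_eq d.2.1 (hlowfin d hd.2)]
            refine tsub_le_self.trans (measure_mono fun x hx => ⟨hx, hd⟩)
          · rw [indicator_of_notMem hd]
            exact bot_le
      _ ≤ volume (⋃ d : jumpSet E, levelSet u d ∩ {_x | (d : ℝ) ∈ Ico s t}) := by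
          refine tsum_meas_le_meas_iUnion_of_disjoint volume
            (fun d => (h.measurableSet_levelSet d).inter (MeasurableSet.const _)) ?_
          intro d d' hdd'
          rw [Function.onFun, disjoint_left]
          exact fun x hx hx' => hdd' (Subtype.ext (hx.1.2.symm.trans hx'.1.2))
      _ ≤ volume A := by
          refine measure_mono (iUnion_subset fun d x hx => (hAmem x).2 ?_)
          rw [hg, hx.1.2]
          exact ⟨hx.1.1, hx.2, d.2.1⟩
  · -- The levels in `[s, t)` at which the running essential supremum has a flat piece.
    set D : Set ℝ := {d | 0 < volume (levelSet u d)} ∩ Ico s t ∩ Ioi 0 with hD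
    have hDc : D.Countable := by
      refine Countable.mono (fun d hd => hd.1.1) (Measure.countable_meas_pos_of_disjoint_iUnion
        (μ := volume) (As := fun d : ℝ => levelSet u d) h.measurableSet_levelSet ?_)
      intro d d' hdd'
      rw [Function.onFun, disjoint_left]
      exact fun x hx hx' => hdd' (hx.2.symm.trans hx'.2)
    have hDm : MeasurableSet D := hDc.measurableSet
    have hDJ : ∀ d ∈ D, d ∈ jumpSet E := fun d hd =>
      h.mem_jumpSet hd.2 (hlowfin d hd.1.2.2) hd.1.1
    have hflat : volume (A ∩ g ⁻¹' D) ≤ ∑' d : D, volume (levelSet u d) := by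
      rw [← measure_biUnion (f := levelSet u) hDc ?_ fun d _ => h.measurableSet_levelSet d]
      · refine measure_mono fun x hx => mem_iUnion₂.2 ⟨g x, hx.2, ((hAmem x).1 hx.1).1, rfl⟩
      · intro d _ d' _ hdd'
        rw [Function.onFun, disjoint_left]
        exact fun x hx hx' => hdd' (hx.2.symm.trans hx'.2)
    have hJ : ∑' d : D, jumpSize E d ≤
        ∑' d : jumpSet E, (Ico s t).indicator (jumpSize E) d := by
      have hinj : Function.Injective fun d : D => (⟨d, hDJ d d.2⟩ : jumpSet E) :=
        fun d d' hdd' => Subtype.ext (Subtype.mk.inj hdd')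
      refine le_trans (ENNReal.tsum_le_tsum fun d => ?_) (ENNReal.tsum_comp_le_tsum_of_injective hinj
        fun d : jumpSet E => (Ico s t).indicator (jumpSize E) d)
      exact (indicator_of_mem d.2.1.2 (jumpSize E)).ge
    have hUD : ∑' d : D, volume {x | u x = d} = volume (u ⁻¹' D) := by
      rw [← measure_biUnion (f := fun d => {x | u x = d}) hDc ?_
        fun d _ => h.measurable (measurableSet_singleton d)]
      · congr 1
        ext x
        simp
      · intro d _ d' _ hdd'
        rw [Function.onFun, disjoint_left]
        exact fun x hx hx' => hdd' ((show u x = d from hx).symm.trans hx')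
    have hBD : B ∩ u ⁻¹' D = u ⁻¹' D :=
      inter_eq_right.2 fun x hx => (hBmem x).2 ⟨hx.1.2, hx.2⟩
    calc volume A = volume (A ∩ g ⁻¹' D) + volume (A \ g ⁻¹' D) :=
          (measure_inter_add_sdiff A (hgm hDm)).symm
      _ ≤ (∑' d : D, (jumpSize E d + volume {x | u x = d})) + volume (B \ u ⁻¹' D) := by
          refine add_le_add (hflat.trans (ENNReal.tsum_le_tsum fun d => ?_)) (measure_mono_ae ?_)
          · rw [h.jumpSize_eq d.2.2 (hlowfin d d.2.1.2.2)]
            exact le_tsub_add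
          · filter_upwards [h.ae_eq_leftEssSup] with x hx hxA
            obtain ⟨hx0, hxst, hxpos⟩ := (hAmem x).1 hxA.1
            have hxu : u x = g x := hx hx0 (by
              by_contra hne
              exact hxA.2 ⟨⟨pos_iff_ne_zero.2 hne, hxst⟩, hxpos⟩)
            refine ⟨(hBmem x).2 ?_, fun hxD => hxA.2 ?_⟩
            · rw [hxu]
              exact ⟨hxst, hxpos⟩
            · rw [mem_preimage, ← hxu]
              exact hxD
      _ = ∑' d : D, jumpSize E d + volume B := by
          rw [ENNReal.tsum_add, hUD, add_assoc, ← measure_inter_add_sdiff B (h.measurable hDm), hBD]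
      _ ≤ _ := by gcongr

end IsProfile

/-! ### The rearrangement as a monotone region -/

namespace IsProfile

variable {E : Set (ℝ × ℝ)} {u : ℝ → ℝ} {K : ℝ}

lemma exists_lt_leftEssSup (h : IsProfile E u K) {t : ℝ} (ht : 0 ≤ t)
    (hpos : volume {x | t < u x} ≠ 0) : ∃ x, t < leftEssSup u x := by
  by_contra! hcon
  refine hpos (measure_mono_null (fun z hz => ?_)
    (measure_iUnion_null fun n : ℕ => (h.leftEssSup_le_iff ht n).1 (hcon n)))
  obtain ⟨n, hn⟩ := exists_nat_gt z
  exact mem_iUnion.2 ⟨n, hz, hn⟩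

lemma volume_lowSet_ne_top (h : IsProfile E u K) {t : ℝ} (ht : 0 ≤ t)
    (hpos : volume {x | t < u x} ≠ 0) : volume (lowSet u t) ≠ ⊤ := by
  obtain ⟨x, hx⟩ := h.exists_lt_leftEssSup ht hpos
  refine ne_top_of_le_ne_top (b := volume (Icc 0 x)) (by simp) (measure_mono fun z hz => ⟨hz.1, ?_⟩)
  exact (h.monotone_leftEssSup.reflect_lt
    (hz.2.elim (fun h' => h'.trans hx) fun h' => (h'.trans ht).trans_lt hx)).le

lemma tauFun_ne_top (h : IsProfile E u K) {t : ℝ} (ht : 0 ≤ t)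
    (hfin : volume (lowSet u t) ≠ ⊤) : tauFun E t ≠ ⊤ := by
  obtain ⟨G, J, U, hG, hJ, -, hJG, -⟩ := h.exists_increments le_rfl ht hfin
  rw [tauFun_zero, zero_add] at hJ
  rw [hJ]
  exact ne_top_of_le_ne_top (ne_top_of_le_ne_top hfin (hG ▸ le_add_self)) hJG

/-- The abscissa `φ_E - τ_E` of the left end of the horizontal section of the rearrangement. -/
noncomputable def leftEnd (E : Set (ℝ × ℝ)) (u : ℝ → ℝ) (t : ℝ) : ℝ :=
  (volume (lowSet u t)).toReal - (tauFun E t).toReal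

/-- The abscissa `φ_E - τ_E + λ_E` of the right end of the horizontal section of the
rearrangement. -/
noncomputable def rightEnd (E : Set (ℝ × ℝ)) (u : ℝ → ℝ) (t : ℝ) : ℝ :=
  leftEnd E u t + (volume (highSet u t)).toReal

lemma leftEnd_le_and_rightEnd_le (h : IsProfile E u K) {s t : ℝ} (hs : 0 ≤ s) (hst : s ≤ t)
    (hfin : volume (lowSet u t) ≠ ⊤) :
    leftEnd E u s ≤ leftEnd E u t ∧ rightEnd E u t ≤ rightEnd E u s := by
  obtain ⟨G, J, U, hG, hJ, hU, hJG, hGJ⟩ := h.exists_increments hs hst hfin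
  have hsfin : volume (lowSet u s) ≠ ⊤ :=
    ne_top_of_le_ne_top hfin (measure_mono (lowSet_mono u hst))
  have hGfin : G ≠ ⊤ := ne_top_of_le_ne_top hfin (hG ▸ le_add_self)
  have hJfin : J ≠ ⊤ := ne_top_of_le_ne_top hGfin hJG
  have hUfin : U ≠ ⊤ := ne_top_of_le_ne_top (h.volume_highSet_lt_top s).ne (hU ▸ le_add_self)
  have hτ := h.tauFun_ne_top hs hsfin
  have h1 := ENNReal.toReal_mono hGfin hJG
  have h2 := ENNReal.toReal_mono (ENNReal.add_ne_top.2 ⟨hJfin, hUfin⟩) hGJ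
  rw [ENNReal.toReal_add hJfin hUfin] at h2
  simp only [leftEnd, rightEnd]
  rw [hG, hJ, hU, ENNReal.toReal_add hsfin hGfin, ENNReal.toReal_add hτ hJfin,
    ENNReal.toReal_add (h.volume_highSet_lt_top t).ne hUfin]
  constructor <;> linarith

lemma mem_rearrangement_iff (h : IsProfile E u K) (x y : ℝ) :
    (x, y) ∈ rearrangement E ↔
      volume (lowSet u |y|) ≠ ⊤ ∧ leftEnd E u |y| < x ∧ x < rightEnd E u |y| := by
  have hτ : tauFun E |y| = tauFun E y := by rw [tauFun, tauFun, abs_abs]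
  simp only [rearrangement, mem_ofPred_eq, h.phiFun_eq, h.lambdaFun_eq, leftEnd, rightEnd, hτ]
  refine and_congr_right fun _ => ?_
  constructor
  · rintro ⟨h1, h2⟩
    rw [ENNReal.ofReal_lt_iff_lt_toReal h1.le (h.volume_highSet_lt_top _).ne] at h2
    constructor <;> linarith
  · rintro ⟨h1, h2⟩
    have h3 : 0 < x - (volume (lowSet u |y|)).toReal + (tauFun E y).toReal := by linarith
    refine ⟨h3, ?_⟩
    rw [ENNReal.ofReal_lt_iff_lt_toReal h3.le (h.volume_highSet_lt_top _).ne]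
    linarith

open Filter Topology in
lemma isMonotoneRegion_rearrangement (h : IsProfile E u K) {M : ℝ} (hM : 0 < M)
    (hlt : ∀ t ∈ Ico 0 M, volume {x | t < u x} ≠ 0) (hgt : ∀ t, M < t → volume (highSet u t) = 0) :
    IsMonotoneRegion (rearrangement E) (leftEnd E u) (rightEnd E u) M := by
  have hfin : ∀ t ∈ Ico 0 M, volume (lowSet u t) ≠ ⊤ := fun t ht =>
    h.volume_lowSet_ne_top ht.1 (hlt t ht)
  have h0 : (0 : ℝ) ∈ Ico 0 M := ⟨le_rfl, hM⟩
  refine ⟨hM, fun s hs t ht hst => (h.leftEnd_le_and_rightEnd_le hs.1 hst (hfin t ht)).1,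
    fun s hs t ht hst => (h.leftEnd_le_and_rightEnd_le hs.1 hst (hfin t ht)).2, fun t ht => ?_,
    fun x hx => ?_, fun x hx => ?_, fun x y hy => ?_, fun x y hxy => ?_, fun x y hxy hy s hs => ?_⟩
  · rw [rightEnd, lt_add_iff_pos_right]
    refine ENNReal.toReal_pos (fun h0 => hlt t ht ?_) (h.volume_highSet_lt_top t).ne
    exact measure_mono_null (show {x | t < u x} ⊆ highSet u t from
      fun z hz => ⟨le_of_lt hz, ht.1.trans_lt hz⟩) h0
  · have hlim := (ENNReal.tendsto_toReal (by rw [← lowSet_zero]; exact hfin 0 h0)).comp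
      (h.tendsto_volume_lowSet le_rfl)
    rw [leftEnd, tauFun_zero, ENNReal.toReal_zero, sub_zero, lowSet_zero]
    refine ge_of_tendsto hlim ?_
    filter_upwards [Ioo_mem_nhdsGT hM] with s hs
    refine (hx s hs).trans ?_
    rw [leftEnd, Function.comp_apply]
    linarith [ENNReal.toReal_nonneg (a := tauFun E s)]
  · have hset : highSet u 0 = {x | 0 < u x} := by
      ext z
      exact ⟨fun hz => hz.2, fun hz => ⟨(show 0 < u z from hz).le, hz⟩⟩
    have hlim := (ENNReal.tendsto_toReal h.volume_lt.ne).comp (tendsto_volume_highSet u le_rfl)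
    rw [← hset] at hlim
    refine le_of_tendsto (hlim.const_add (leftEnd E u 0)) ?_
    filter_upwards [Ioo_mem_nhdsGT hM] with s hs
    refine le_trans ?_ (hx s hs)
    rw [rightEnd, Function.comp_apply]
    linarith [(h.leftEnd_le_and_rightEnd_le le_rfl hs.1.le (hfin s ⟨hs.1.le, hs.2⟩)).1]
  · rw [h.mem_rearrangement_iff]
    exact and_iff_right (hfin _ ⟨abs_nonneg y, hy⟩)
  · obtain ⟨-, h1, h2⟩ := (h.mem_rearrangement_iff x y).1 hxy
    by_contra hcon
    rw [rightEnd, hgt _ (not_le.1 hcon), ENNReal.toReal_zero, add_zero] at h2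
    exact lt_asymm h1 h2
  · obtain ⟨h1, h2, h3⟩ := (h.mem_rearrangement_iff x y).1 hxy
    obtain ⟨h4, h5⟩ := h.leftEnd_le_and_rightEnd_le hs.1 (hy ▸ hs.2.le) h1
    exact ⟨h4.trans h2.le, h3.le.trans h5⟩

lemma rearrangement_eq_empty (h : IsProfile E u K) (h0 : volume {x | 0 < u x} = 0) :
    rearrangement E = ∅ := by
  rw [eq_empty_iff_forall_notMem]
  rintro ⟨x, y⟩ hxy
  obtain ⟨-, h1, h2⟩ := (h.mem_rearrangement_iff x y).1 hxy
  rw [rightEnd, measure_mono_null (fun z hz => hz.2) h0, ENNReal.toReal_zero, add_zero] at h2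
  exact lt_asymm h1 h2

lemma rearrangement_isBounded_and_isPiecewiseLipschitz (h : IsProfile E u K) :
    Bornology.IsBounded (rearrangement E) ∧ IsPiecewiseLipschitz (frontier (rearrangement E)) := by
  by_cases h0 : volume {x | 0 < u x} = 0
  · rw [h.rearrangement_eq_empty h0, frontier_empty]
    exact ⟨Bornology.isBounded_empty, isPiecewiseLipschitz_empty⟩
  set T : Set ℝ := {t | 0 ≤ t ∧ volume {x | t < u x} ≠ 0} with hT
  have hT0 : (0 : ℝ) ∈ T := ⟨le_rfl, h0⟩
  have hbdd : BddAbove T := by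
    refine ⟨K, fun t ht => not_lt.1 fun hKt => ht.2 ?_⟩
    rw [measure_eq_zero_iff_ae_notMem]
    filter_upwards [h.le] with x hx hx'
    exact absurd (hKt.trans hx') (not_lt.2 hx)
  have hlt : ∀ t ∈ Ico 0 (sSup T), volume {x | t < u x} ≠ 0 := by
    rintro t ⟨-, ht⟩ hnull
    obtain ⟨s, hs, hts⟩ := exists_lt_of_lt_csSup ⟨0, hT0⟩ ht
    exact hs.2 (measure_mono_null (fun x hx => hts.trans hx) hnull)
  have hgt : ∀ t, sSup T < t → volume (highSet u t) = 0 := by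
    intro t ht
    obtain ⟨s, hs1, hs2⟩ := exists_between ht
    have hsT : s ∉ T := fun hsT => absurd (le_csSup hbdd hsT) (not_le.2 hs1)
    have hs0 : 0 ≤ s := (le_csSup hbdd hT0).trans hs1.le
    refine measure_mono_null (fun x hx => ?_) (by simpa [hT, hs0] using hsT)
    exact hs2.trans_le hx.1
  have hM : 0 < sSup T := by
    -- Some level set `{u > 1 / (n + 1)}` has positive measure.
    by_contra hcon
    refine h0 (measure_mono_null (t := ⋃ n : ℕ, highSet u (1 / ((n : ℝ) + 1))) (fun x hx => ?_)
      (measure_iUnion_null fun n => hgt _ ((not_lt.1 hcon).trans_lt (by positivity))))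
    obtain ⟨n, hn⟩ := exists_nat_one_div_lt (show 0 < u x from hx)
    exact mem_iUnion.2 ⟨n, hn.le, hx⟩
  have hreg := h.isMonotoneRegion_rearrangement hM hlt hgt
  exact ⟨hreg.isBounded, hreg.isPiecewiseLipschitz_frontier⟩

end IsProfile

/-! ### `x`-convex sets as monotone regions -/

lemma IsOpenInterval.eq_Ioo {I : Set ℝ} (hI : IsOpenInterval I) (hne : I.Nonempty)
    (hb : BddBelow I) (ha : BddAbove I) : I = Ioo (sInf I) (sSup I) := by
  refine subset_antisymm (fun x hx => ?_) fun x hx => ?_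
  · obtain ⟨ε, hε, hball⟩ := Metric.isOpen_iff.1 hI.1 x hx
    have h1 : x - ε / 2 ∈ I := hball (by
      rw [Metric.mem_ball, Real.dist_eq, abs_lt]
      constructor <;> linarith)
    have h2 : x + ε / 2 ∈ I := hball (by
      rw [Metric.mem_ball, Real.dist_eq, abs_lt]
      constructor <;> linarith)
    exact ⟨by linarith [csInf_le hb h1], by linarith [le_csSup ha h2]⟩
  · obtain ⟨a, ha', hax⟩ := exists_lt_of_csInf_lt hne hx.1
    obtain ⟨b, hb', hxb⟩ := exists_lt_of_lt_csSup hne hx.2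
    exact hI.2.out ha' hb' ⟨hax.le, hxb.le⟩

lemma IsOpenInterval.bddAbove_of_volume_lt_top {I : Set ℝ} (hI : IsOpenInterval I)
    (hfin : volume I < ⊤)
    (hb : BddBelow I) : BddAbove I := by
  by_contra hcon
  rcases I.eq_empty_or_nonempty with rfl | ⟨x, hx⟩
  · exact hcon bddAbove_empty
  · have hsub : Ici x ⊆ I := by
      intro z hz
      obtain ⟨w, hw, hzw⟩ := not_bddAbove_iff.1 hcon z
      exact hI.2.out hx hw ⟨hz, hzw.le⟩
    have := (measure_mono hsub).trans_lt hfin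
    simp at this

/-- If `E` is `x`-convex, its section at height `t` is the open interval `(inf A_t, sup A_t)`, and these
sections decrease with `|t|`. Since they are open, a section that is not empty is not negligible, so
the almost everywhere bounds on the profile bound `E` itself. -/
lemma isBounded_and_isPiecewiseLipschitz_of_isXConvex {E : Set (ℝ × ℝ)} {u : ℝ → ℝ} {K : ℝ}
    (h : IsProfile E u K) (hEH : E ⊆ closedHalfPlane) (hschwarz : IsYSchwarzSymmetric E)
    (hconv : IsXConvex E) :
    Bornology.IsBounded E ∧ IsPiecewiseLipschitz (frontier E) := by
  obtain ⟨hsymm, hyconv⟩ := hschwarz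
  set A : ℝ → Set ℝ := horizSection E with hA
  rcases E.eq_empty_or_nonempty with rfl | ⟨⟨x₀, y₀⟩, hxy₀⟩
  · rw [frontier_empty]
    exact ⟨Bornology.isBounded_empty, isPiecewiseLipschitz_empty⟩
  have habs : ∀ x y, (x, y) ∈ E ↔ (x, |y|) ∈ E := by
    intro x y
    rcases abs_choice y with hy | hy <;> rw [hy]
    exact ⟨hsymm x y, fun hxy => by simpa using hsymm x (-y) hxy⟩
  have hanti : ∀ x s t, 0 ≤ s → s ≤ t → (x, t) ∈ E → (x, s) ∈ E := fun x s t hs hst hxt =>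
    (hyconv x).2.out (hsymm x t hxt) hxt ⟨by linarith, hst⟩
  have hup : ∀ x t, (x, t) ∈ E → ∃ ε > 0, (x, t + ε) ∈ E := by
    intro x t hxt
    obtain ⟨ε, hε, hball⟩ := Metric.isOpen_iff.1 (hyconv x).1 t hxt
    exact ⟨ε / 2, by linarith, hball (by
      rw [Metric.mem_ball, Real.dist_eq, abs_lt]
      constructor <;> linarith)⟩
  have hmeasA : ∀ t, volume (A t) = volume {x | |t| < u x} := h.sectionLength_eq
  have hbelow : ∀ t, BddBelow (A t) := fun t => ⟨0, fun x hx => hEH hx⟩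
  have hAsub : ∀ s t, 0 ≤ s → s ≤ t → A t ⊆ A s := fun s t hs hst x hx => hanti x s t hs hst hx
  have habove : ∀ t, 0 ≤ t → BddAbove (A t) := by
    intro t ht
    refine ((hconv 0).bddAbove_of_volume_lt_top ?_ (hbelow 0)).mono (hAsub 0 t le_rfl ht)
    rw [show volume (horizSection E 0) = _ from hmeasA 0, abs_zero]
    exact h.volume_lt
  have hle : ∀ t, (A t).Nonempty → |t| ≤ K := by
    rintro t hne
    by_contra hcon
    refine ((hconv t).1.measure_pos volume hne).ne' ?_
    rw [show volume (horizSection E t) = _ from hmeasA t, measure_eq_zero_iff_ae_notMem]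
    filter_upwards [h.le] with x hx hx'
    exact absurd ((not_le.1 hcon).trans hx') (not_lt.2 hx)
  set T : Set ℝ := {t | 0 ≤ t ∧ (A t).Nonempty} with hT
  have hTne : |y₀| ∈ T := ⟨abs_nonneg _, x₀, (habs x₀ y₀).1 hxy₀⟩
  have hbdd : BddAbove T := ⟨K, fun t ht => (le_abs_self t).trans (hle t ht.2)⟩
  have hTlt : ∀ t ∈ T, t < sSup T := by
    rintro t ⟨ht, x, hx⟩
    obtain ⟨ε, hε, hxε⟩ := hup x t hx
    linarith [le_csSup hbdd (show t + ε ∈ T from ⟨by linarith, x, hxε⟩)]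
  have hM : 0 < sSup T := (abs_nonneg _).trans_lt (hTlt _ hTne)
  have hne : ∀ t ∈ Ico 0 (sSup T), (A t).Nonempty := by
    rintro t ⟨ht0, ht⟩
    obtain ⟨s, hs, hts⟩ := exists_lt_of_lt_csSup ⟨_, hTne⟩ ht
    exact hs.2.mono (hAsub t s ht0 hts.le)
  have hIoo : ∀ t ∈ Ico 0 (sSup T), A t = Ioo (sInf (A t)) (sSup (A t)) := fun t ht =>
    (hconv t).eq_Ioo (hne t ht) (hbelow t) (habove t ht.1)
  have hmem : ∀ x y, (x, y) ∈ E → |y| < sSup T := fun x y hxy =>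
    hTlt _ ⟨abs_nonneg y, x, (habs x y).1 hxy⟩
  have hsmall : ∀ x ∈ A 0, ∃ s ∈ Ioo 0 (sSup T), x ∈ A s := by
    intro x hx
    obtain ⟨ε, hε, hxε⟩ := hup x 0 hx
    rw [zero_add] at hxε
    exact ⟨ε, ⟨hε, (le_abs_self ε).trans_lt (hmem x ε hxε)⟩, hxε⟩
  have hreg : IsMonotoneRegion E (fun t => sInf (A t)) (fun t => sSup (A t)) (sSup T) := by
    refine ⟨hM, fun s hs t ht hst => ?_, fun s hs t ht hst => ?_, fun t ht => ?_, fun x hx => ?_,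
      fun x hx => ?_, fun x y hy => ?_, fun x y hxy => (hmem x y hxy).le,
      fun x y hxy hy => absurd hy (hmem x y hxy).ne⟩
    · exact csInf_le_csInf (hbelow s) (hne t ht) (hAsub s t hs.1 hst)
    · exact csSup_le_csSup (habove s hs.1) (hne t ht) (hAsub s t hs.1 hst)
    · have := hne t ht
      rw [hIoo t ht] at this
      exact nonempty_Ioo.1 this
    · refine le_csInf (hne 0 ⟨le_rfl, hM⟩) fun z hz => ?_
      obtain ⟨s, hs, hzs⟩ := hsmall z hz
      exact (hx s hs).trans (csInf_le (hbelow s) hzs)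
    · refine csSup_le (hne 0 ⟨le_rfl, hM⟩) fun z hz => ?_
      obtain ⟨s, hs, hzs⟩ := hsmall z hz
      exact (le_csSup (habove s hs.1.le) hzs).trans (hx s hs)
    · rw [habs]
      change x ∈ A |y| ↔ x ∈ Ioo (sInf (A |y|)) (sSup (A |y|))
      rw [← hIoo |y| ⟨abs_nonneg y, hy⟩]
  exact ⟨hreg.isBounded, hreg.isPiecewiseLipschitz_frontier⟩

theorem proposition3p6 (E : Set (ℝ × ℝ)) (hEH : E ⊆ closedHalfPlane)
    (hmeas : NullMeasurableSet E volume) (harea : volume E < ⊤) (hper : perimeter E < ⊤)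
    (hschwarz : IsYSchwarzSymmetric E) :
    (IsXConvex E → Bornology.IsBounded E ∧ IsPiecewiseLipschitz (frontier E)) ∧
    (Bornology.IsBounded (rearrangement E) ∧
      IsPiecewiseLipschitz (frontier (rearrangement E))) := by
  obtain ⟨u, K, h⟩ := exists_isProfile hEH hmeas harea hper hschwarz
  exact ⟨isBounded_and_isPiecewiseLipschitz_of_isXConvex h hEH hschwarz,
    h.rearrangement_isBounded_and_isPiecewiseLipschitz⟩
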